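/- Let $\mathcal{C}$ be a model category (finite limits and colimits, two-out-of-three, retracts, lifting, and not necessarily functorial factorizations) and let $\mathcal{Q}$ be a poset. For a monotone map $\alpha\colon\mathcal{D}\to\mathcal{Q}$ with $\mathcal{D}$ a finite poset, a functor $X\colon\mathcal{Q}\to\mathcal{C}$ is *discretized* by $\alpha$ if $X$ is isomorphic to the left Kan extension along $\alpha$ of some functor $\mathcal{D}\to\mathcal{C}$; $X$ is *tame* if it is discretized by some such $\alpha$, and $\mathrm{Tame}(\mathcal{Q},\mathcal{C})\subset\mathrm{Fun}(\mathcal{Q},\mathcal{C})$ denotes the full subcategory of tame functors. The map $\alpha$ *admits a transfer* if the induced map $\alpha_*\colon\mathcal{D}\cup\{-\infty\}\to\mathcal{Q}\cup\{-\infty\}$ (a new global minimum is added to both posets and preserved) has a monotone right adjoint. For $\mathcal{D}$ a finite poset, a morphism $\varphi\colon X\to Y$ in $\mathrm{Fun}(\mathcal{D},\mathcal{C})$ is a *projective cofibration* if for every $x\in\mathcal{D}$ the mediating morphism $$\mathrm{colim}\bigl(\mathrm{colim}_{d<x}Y(d)\leftarrow \mathrm{colim}_{d<x}X(d)\to X(x)\bigr)\to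 Y(x)$$ is a cofibration in $\mathcal{C}$. A model category satisfies the *minimal cofibrant factorization axiom* if every morphism $f\colon X\to Y$ factors as $f=\pi c$ with $c\colon X\to W$ a cofibration and $\pi\colon W\to Y$ both a fibration and a weak equivalence, such that every $\psi\colon W\to W$ with $\psi c=c$ and $\pi\psi=\pi$ is an isomorphism. Assume that every tame functor $\mathcal{Q}\to\mathcal{C}$ is discretized by some monotone map from a finite poset that admits a transfer. Assume moreover that $\mathcal{C}$ has a zero object or that there is a finite subset $S\subset\mathcal{Q}$ such that every element of $\mathcal{Q}$ is greater than or equal to some element of $S$. Then the following classes of morphisms define a model structure on $\mathrm{Tame}(\mathcal{Q},\mathcal{C})$. A morphism $\varphi\colon X\to Y$ is - a weak equivalence (respectively, a fibration) if $\varphi(x)\colon X(x)\to Y(x)$ is a weak equivalence (respectively, a fibration) in $\mathcal{C}$ for every $x\in\mathcal{Q}$; - a cofibration if there is a finite full subposet $\mathcal{D}\subset\mathcal{Q}$ whose inclusion discretizes both $X$ and $Y$ and such that the restriction of $\varphi$ to $\mathcal{D}$ is a projective cofibration in $\mathrm{Fun}(\mathcal{D},\mathcal{C})$. Furthermore, if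 $\mathcal{C}$ satisfies the minimal cofibrant factorization axiom, then so does $\mathrm{Tame}(\mathcal{Q},\mathcal{C})$ with this model structure. -/

import Mathlib

open CategoryTheory Limits HomotopicalAlgebra

universe w w' v u

namespace TameFunctors

section Tameness

variable {Q : Type w} [PartialOrder Q] {D : Type w'} [PartialOrder D]
  {C : Type u} [Category.{v} C]

/-- A monotone map `α : D → Q` admits a transfer if the induced map `α_* : D_* → Q_*`, where `D_*`
and `Q_*` are obtained by adjoining a global minimum `-∞`, has a (monotone) right adjoint. -/
def AdmitsTransfer (α : D →o Q) : Prop :=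
  ∃ t : WithBot Q →o WithBot D, GaloisConnection α.withBotMap t

/-- `X : Q ⥤ C` is discretized by `α : D → Q` if `X` is (isomorphic to) the left Kan extension
along `α` of some functor `Y : D ⥤ C`. -/
def Discretizes (α : D →o Q) (X : Q ⥤ C) : Prop :=
  ∃ (Y : D ⥤ C) (η : Y ⟶ α.monotone.functor ⋙ X), X.IsLeftKanExtension η

variable (Q C) in
/-- `X : Q ⥤ C` is tame if it is discretized by some monotone map from a finite poset. -/
def isTame : ObjectProperty (Q ⥤ C) := fun X ↦
  ∃ (D : Type w) (_ : PartialOrder D) (_ : Finite D) (α : D →o Q), Discretizes α X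

variable (Q C) in
/-- The full subcategory of tame functors in `Q ⥤ C`. -/
abbrev Tame : Type _ := (isTame Q C).FullSubcategory

/-- The inclusion of a finite full subposet. -/
abbrev finiteInclusion (S : Finset Q) : {q : Q // q ∈ S} →o Q := OrderHom.Subtype.val (· ∈ S)

end Tameness

section ProjectiveCofibrations

variable {D : Type w} [PartialOrder D] [Finite D] {C : Type u} [Category.{v} C]

instance hasColimitsOfShape_of_finite_poset [HasFiniteColimits C] : HasColimitsOfShape D C := by
  have : Fintype D := Fintype.ofFinite D
  exact hasColimitsOfShape_of_hasFiniteColimits C D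

variable [HasFiniteColimits C]

/-- The inclusion of `{d | d < x}` into `D`. -/
abbrev belowIncl (x : D) : Set.Iio x ⥤ D := (Subtype.mono_coe (· ∈ Set.Iio x)).functor

/-- The colimit of `X` over `{d | d < x}`. -/
noncomputable abbrev colimBelow (X : D ⥤ C) (x : D) : C := colimit (belowIncl x ⋙ X)

/-- The cocone with point `X(x)` given by the maps `X(d) → X(x)` for `d < x`. -/
def coconeBelow (X : D ⥤ C) (x : D) : Cocone (belowIncl x ⋙ X) where
  pt := X.obj x
  ι :=
    { app := fun d ↦ X.map (homOfLE d.2.le)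
      naturality := fun d d' f ↦
        (X.map_comp ((belowIncl x).map f) (homOfLE d'.2.le)).symm.trans
          (Category.comp_id (X.map (homOfLE d.2.le))).symm }

/-- The morphism from the colimit of `X` over `{d | d < x}` to `X(x)`. -/
noncomputable def colimBelowTo (X : D ⥤ C) (x : D) : colimBelow X x ⟶ X.obj x :=
  colimit.desc (belowIncl x ⋙ X) (coconeBelow X x)

/-- The morphism induced by `φ` on colimits over `{d | d < x}`. -/
noncomputable def colimBelowMap {X Y : D ⥤ C} (φ : X ⟶ Y) (x : D) :
    colimBelow X x ⟶ colimBelow Y x :=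
  colimMap (Functor.whiskerLeft (belowIncl x) φ)

lemma colimBelow_comm {X Y : D ⥤ C} (φ : X ⟶ Y) (x : D) :
    colimBelowMap φ x ≫ colimBelowTo Y x = colimBelowTo X x ≫ φ.app x := by
  refine colimit.hom_ext fun d ↦ ?_
  have hY : colimit.ι (belowIncl x ⋙ Y) d ≫ colimBelowTo Y x = Y.map (homOfLE d.2.le) :=
    colimit.ι_desc (coconeBelow Y x) d
  have hX : colimit.ι (belowIncl x ⋙ X) d ≫ colimBelowTo X x = X.map (homOfLE d.2.le) :=
    colimit.ι_desc (coconeBelow X x) d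
  have hφ : colimit.ι (belowIncl x ⋙ X) d ≫ colimBelowMap φ x =
      (Functor.whiskerLeft (belowIncl x) φ).app d ≫ colimit.ι (belowIncl x ⋙ Y) d :=
    ι_colimMap (Functor.whiskerLeft (belowIncl x) φ) d
  rw [reassoc_of% hφ, reassoc_of% hX]
  exact (congrArg (φ.app d.1 ≫ ·) hY).trans (φ.naturality _).symm

/-- The mediating morphism from the pushout of
`colim_{d < x} Y(d) ← colim_{d < x} X(d) → X(x)` to `Y(x)`. -/
noncomputable def mediating {X Y : D ⥤ C} (φ : X ⟶ Y) (x : D) :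
    pushout (colimBelowMap φ x) (colimBelowTo X x) ⟶ Y.obj x :=
  pushout.desc (colimBelowTo Y x) (φ.app x) (colimBelow_comm φ x)

/-- The projective cofibrations in `D ⥤ C`, for `D` a finite poset. -/
def projectiveCofibrations [CategoryWithCofibrations C] : MorphismProperty (D ⥤ C) :=
  fun _ _ φ ↦ ∀ x : D, Cofibration (mediating φ x)

end ProjectiveCofibrations

section ModelStructure

variable (Q : Type w) [PartialOrder Q] (C : Type u) [Category.{v} C] [ModelCategory C]

/-- Objectwise weak equivalences between tame functors. -/
def tameWeakEquivalences : MorphismProperty (Tame Q C) :=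
  fun _ _ φ ↦ ∀ x : Q, WeakEquivalence (φ.hom.app x)

/-- Objectwise fibrations between tame functors. -/
def tameFibrations : MorphismProperty (Tame Q C) :=
  fun _ _ φ ↦ ∀ x : Q, Fibration (φ.hom.app x)

/-- Morphisms of tame functors whose restriction to some finite full subposet, discretizing both
the source and the target, is a projective cofibration. -/
def tameCofibrations : MorphismProperty (Tame Q C) :=
  fun X Y φ ↦ ∃ S : Finset Q,
    Discretizes (finiteInclusion S) X.obj ∧ Discretizes (finiteInclusion S) Y.obj ∧
      projectiveCofibrations (Functor.whiskerLeft (finiteInclusion S).monotone.functor φ.hom)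

end ModelStructure

section Minimality

variable {C : Type u} [Category.{v} C]

/-- The factorization `c ≫ p` is minimal if every endomorphism of it is an isomorphism. -/
def IsMinimalFactorization {X W Y : C} (c : X ⟶ W) (p : W ⟶ Y) : Prop :=
  ∀ φ : W ⟶ W, c ≫ φ = c → φ ≫ p = p → IsIso φ

variable (C) in
/-- Every morphism admits a minimal factorization as a cofibration followed by a fibration that is
a weak equivalence. -/
def MinimalCofibrantFactorizationAxiom [ModelCategory C] : Prop :=
  ∀ ⦃X Y : C⦄ (f : X ⟶ Y), ∃ (W : C) (c : X ⟶ W) (p : W ⟶ Y),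
    c ≫ p = f ∧ Cofibration c ∧ Fibration p ∧ WeakEquivalence p ∧ IsMinimalFactorization c p

end Minimality

end TameFunctors

open TameFunctors

namespace TameFunctors

/-! Over a finite poset `D`, a weak factorization system `(L, R)` on `C` induces one on `D ⥤ C`:
mediating morphisms in `L` on the left, objectwise `R` on the right. Lifts and factorizations are
built one element at a time along lower sets (`exists_lift_on_lowerSet`,
`exists_factorization_of_latch`).

A tame functor is recovered from its restriction to some finite `S ⊆ Q` (`isTame_iff`), so lifts and
factorizations extend from `S` to `Q`. Objectwise properties need not extend, since colimits need
not preserve fibrations or weak equivalences. Here transfers enter: the image of a map admitting one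
has floors, so a generated functor takes at `q` its value at the floor of `q`, or an initial object
(`HasFloors.objectwise`).

The hypothesis gives floors for one functor at a time, while a morphism or a diagram needs a common
`S`. If `C` has two distinct parallel morphisms, every finite set lies in a floored one
(`exists_hasFloors_superset`). Otherwise `C` is thin: constructions can be made objectwise and only
tameness of the result is at stake (`isTame_of_isThin`).

Finite colimits of tame functors are tame. For finite limits the extra assumption handles the points
with no generator below them, where a limit of initial objects has to be initial. Minimal
factorizations come from minimal factorizations of the mediating morphisms. -/

lemma finset_lowerSet_induction {D : Type*} [PartialOrder D] [DecidableEq D] {p : Finset D → Prop}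
    (empty : p ∅)
    (insert : ∀ (U : Finset D) (x : D), IsLowerSet (U : Set D) → x ∉ U → (∀ d < x, d ∈ U) →
      p U → p (insert x U))
    (U : Finset D) (hU : IsLowerSet (U : Set D)) : p U := by
  induction U using Finset.strongInduction with
  | H U ih =>
    rcases U.eq_empty_or_nonempty with rfl | hne
    · exact empty
    obtain ⟨x, hx⟩ := U.exists_maximal hne
    have hlow : IsLowerSet ((U.erase x : Finset D) : Set D) := by
      intro a b hba ha
      simp only [Finset.coe_erase, Set.mem_sdiff, Finset.mem_coe, Set.mem_singleton_iff] at ha ⊢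
      exact ⟨hU hba ha.1, fun h ↦ ha.2 (le_antisymm (hx.2 ha.1 (h ▸ hba)) (h ▸ hba))⟩
    have := insert (U.erase x) x hlow (by simp)
      (fun d hd ↦ Finset.mem_erase.2 ⟨hd.ne, hU hd.le hx.1⟩)
      (ih _ (Finset.erase_ssubset hx.1) hlow)
    rwa [Finset.insert_erase hx.1] at this

/-! ### Latching objects and mediating morphisms -/

section Latching

variable {D : Type w} [PartialOrder D] [Finite D] {C : Type u} [Category.{v} C]
  [HasFiniteColimits C]

/-- The inclusion of `X(d)` into the colimit of `X` over the elements below `x`, for `d < x`. -/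
noncomputable def ιBelow (X : D ⥤ C) {d x : D} (h : d < x) : X.obj d ⟶ colimBelow X x :=
  colimit.ι (belowIncl x ⋙ X) ⟨d, h⟩

lemma colimBelow_hom_ext {X : D ⥤ C} {x : D} {Z : C} {f g : colimBelow X x ⟶ Z}
    (h : ∀ (d : D) (hd : d < x), ιBelow X hd ≫ f = ιBelow X hd ≫ g) : f = g :=
  colimit.hom_ext fun d ↦ h d.1 d.2

@[simp]
lemma map_ιBelow (X : D ⥤ C) {d d' x : D} (f : d ⟶ d') (h : d' < x) :
    X.map f ≫ ιBelow X h = ιBelow X ((leOfHom f).trans_lt h) :=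
  colimit.w (belowIncl x ⋙ X) (j := ⟨d', h⟩) (j' := ⟨d, (leOfHom f).trans_lt h⟩)
    (homOfLE (leOfHom f))

@[simp]
lemma map_ιBelow_assoc (X : D ⥤ C) {d d' x : D} (f : d ⟶ d') (h : d' < x) {Z : C}
    (k : colimBelow X x ⟶ Z) :
    X.map f ≫ ιBelow X h ≫ k = ιBelow X ((leOfHom f).trans_lt h) ≫ k := by
  rw [← Category.assoc, map_ιBelow]

@[simp]
lemma ιBelow_colimBelowTo (X : D ⥤ C) {d x : D} (h : d < x) :
    ιBelow X h ≫ colimBelowTo X x = X.map (homOfLE h.le) :=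
  colimit.ι_desc (coconeBelow X x) ⟨d, h⟩

@[simp]
lemma ιBelow_colimBelowTo_assoc (X : D ⥤ C) {d x : D} (h : d < x) {Z : C} (k : X.obj x ⟶ Z) :
    ιBelow X h ≫ colimBelowTo X x ≫ k = X.map (homOfLE h.le) ≫ k := by
  rw [← Category.assoc, ιBelow_colimBelowTo]

@[simp]
lemma ιBelow_colimBelowMap {X Y : D ⥤ C} (φ : X ⟶ Y) {d x : D} (h : d < x) :
    ιBelow X h ≫ colimBelowMap φ x = φ.app d ≫ ιBelow Y h :=
  ι_colimMap (Functor.whiskerLeft (belowIncl x) φ) ⟨d, h⟩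

@[simp]
lemma ιBelow_colimBelowMap_assoc {X Y : D ⥤ C} (φ : X ⟶ Y) {d x : D} (h : d < x) {Z : C}
    (k : colimBelow Y x ⟶ Z) :
    ιBelow X h ≫ colimBelowMap φ x ≫ k = φ.app d ≫ ιBelow Y h ≫ k := by
  rw [← Category.assoc, ιBelow_colimBelowMap, Category.assoc]

lemma colimBelow_exists_desc (X : D ⥤ C) (x : D) {Z : C} (k : ∀ d, d < x → (X.obj d ⟶ Z))
    (hk : ∀ (d d' : D) (f : d ⟶ d') (hd' : d' < x),
      X.map f ≫ k d' hd' = k d ((leOfHom f).trans_lt hd')) :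
    ∃ s : colimBelow X x ⟶ Z, ∀ d (hd : d < x), ιBelow X hd ≫ s = k d hd := by
  let c : Cocone (belowIncl x ⋙ X) :=
    { pt := Z
      ι := { app := fun d ↦ k d.1 d.2
             naturality := fun d d' f ↦ by
              have := hk d.1 d'.1 ((belowIncl x).map f) d'.2
              exact this.trans (Category.comp_id _).symm } }
  exact ⟨colimit.desc _ c, fun d hd ↦ colimit.ι_desc c ⟨d, hd⟩⟩

lemma colimBelowMap_comp {X Y Z : D ⥤ C} (φ : X ⟶ Y) (ψ : Y ⟶ Z) (x : D) :
    colimBelowMap (φ ≫ ψ) x = colimBelowMap φ x ≫ colimBelowMap ψ x :=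
  colimBelow_hom_ext fun d hd ↦ by simp

lemma isIso_colimBelowMap {X Y : D ⥤ C} (φ : X ⟶ Y) (x : D) (h : ∀ d < x, IsIso (φ.app d)) :
    IsIso (colimBelowMap φ x) := by
  have : IsIso (Functor.whiskerLeft (belowIncl x) φ) := by
    have : ∀ d, IsIso ((Functor.whiskerLeft (belowIncl x) φ).app d) := fun d ↦ h d.1 d.2
    exact NatIso.isIso_of_isIso_app _
  let e := asIso (Functor.whiskerLeft (belowIncl x) φ)
  exact (HasColimit.isoOfNatIso e).isIso_hom

/-- The pushout of `colim_{d < x} Y(d) ← colim_{d < x} X(d) → X(x)`. -/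
noncomputable abbrev latch {X Y : D ⥤ C} (φ : X ⟶ Y) (x : D) : C :=
  pushout (colimBelowMap φ x) (colimBelowTo X x)

@[simp]
lemma inl_mediating {X Y : D ⥤ C} (φ : X ⟶ Y) (x : D) :
    pushout.inl _ _ ≫ mediating φ x = colimBelowTo Y x :=
  pushout.inl_desc _ _ _

@[simp]
lemma inl_mediating_assoc {X Y : D ⥤ C} (φ : X ⟶ Y) (x : D) {Z : C} (k : Y.obj x ⟶ Z) :
    pushout.inl _ _ ≫ mediating φ x ≫ k = colimBelowTo Y x ≫ k := by
  rw [← Category.assoc, inl_mediating]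

@[simp]
lemma inr_mediating {X Y : D ⥤ C} (φ : X ⟶ Y) (x : D) :
    pushout.inr _ _ ≫ mediating φ x = φ.app x :=
  pushout.inr_desc _ _ _

@[simp]
lemma inr_mediating_assoc {X Y : D ⥤ C} (φ : X ⟶ Y) (x : D) {Z : C} (k : Y.obj x ⟶ Z) :
    pushout.inr _ _ ≫ mediating φ x ≫ k = φ.app x ≫ k := by
  rw [← Category.assoc, inr_mediating]

/-- The functoriality of `latch` with respect to commutative squares. -/
noncomputable def latchMap {X Y X' Y' : D ⥤ C} (φ : X ⟶ Y) (φ' : X' ⟶ Y') (a : X ⟶ X')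
    (b : Y ⟶ Y') (h : a ≫ φ' = φ ≫ b) (x : D) : latch φ x ⟶ latch φ' x :=
  pushout.map _ _ _ _ (colimBelowMap b x) (a.app x) (colimBelowMap a x)
    (by rw [← colimBelowMap_comp, ← colimBelowMap_comp, h]) (colimBelow_comm a x).symm

@[simp]
lemma inl_latchMap {X Y X' Y' : D ⥤ C} (φ : X ⟶ Y) (φ' : X' ⟶ Y') (a : X ⟶ X')
    (b : Y ⟶ Y') (h : a ≫ φ' = φ ≫ b) (x : D) :
    pushout.inl _ _ ≫ latchMap φ φ' a b h x = colimBelowMap b x ≫ pushout.inl _ _ :=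
  pushout.inl_desc _ _ _

@[simp]
lemma inl_latchMap_assoc {X Y X' Y' : D ⥤ C} (φ : X ⟶ Y) (φ' : X' ⟶ Y') (a : X ⟶ X')
    (b : Y ⟶ Y') (h : a ≫ φ' = φ ≫ b) (x : D) {Z : C} (k : latch φ' x ⟶ Z) :
    pushout.inl _ _ ≫ latchMap φ φ' a b h x ≫ k =
      colimBelowMap b x ≫ pushout.inl _ _ ≫ k := by
  rw [← Category.assoc, inl_latchMap, Category.assoc]

@[simp]
lemma inr_latchMap {X Y X' Y' : D ⥤ C} (φ : X ⟶ Y) (φ' : X' ⟶ Y') (a : X ⟶ X')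
    (b : Y ⟶ Y') (h : a ≫ φ' = φ ≫ b) (x : D) :
    pushout.inr _ _ ≫ latchMap φ φ' a b h x = a.app x ≫ pushout.inr _ _ :=
  pushout.inr_desc _ _ _

@[simp]
lemma inr_latchMap_assoc {X Y X' Y' : D ⥤ C} (φ : X ⟶ Y) (φ' : X' ⟶ Y') (a : X ⟶ X')
    (b : Y ⟶ Y') (h : a ≫ φ' = φ ≫ b) (x : D) {Z : C} (k : latch φ' x ⟶ Z) :
    pushout.inr _ _ ≫ latchMap φ φ' a b h x ≫ k = a.app x ≫ pushout.inr _ _ ≫ k := by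
  rw [← Category.assoc, inr_latchMap, Category.assoc]

lemma latchMap_mediating {X Y X' Y' : D ⥤ C} (φ : X ⟶ Y) (φ' : X' ⟶ Y') (a : X ⟶ X')
    (b : Y ⟶ Y') (h : a ≫ φ' = φ ≫ b) (x : D) :
    latchMap φ φ' a b h x ≫ mediating φ' x = mediating φ x ≫ b.app x := by
  apply pushout.hom_ext
  · simp [colimBelow_comm]
  · have := NatTrans.congr_app h x
    simp only [NatTrans.comp_app] at this
    simp [this]

/-- The pushout sees the target only strictly below `x`, so nothing is asked of `b` at `x` itself.
This is what makes induction along `D` possible. -/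
lemma isIso_latchMap_id {X Y Y' : D ⥤ C} (φ : X ⟶ Y) (φ' : X ⟶ Y')
    (b : Y ⟶ Y') (h : 𝟙 X ≫ φ' = φ ≫ b) (x : D) (hb : ∀ d < x, IsIso (b.app d)) :
    IsIso (latchMap φ φ' (𝟙 X) b h x) := by
  have := isIso_colimBelowMap b x hb
  have := isIso_colimBelowMap (𝟙 X) x (fun d _ ↦ inferInstanceAs (IsIso (𝟙 (X.obj d))))
  have : IsIso ((𝟙 X : X ⟶ X).app x) := inferInstanceAs (IsIso (𝟙 (X.obj x)))
  exact pushout.map_isIso _ _ _ _ (colimBelowMap b x) ((𝟙 X : X ⟶ X).app x)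
    (colimBelowMap (𝟙 X) x)
    (by rw [← colimBelowMap_comp, ← colimBelowMap_comp, h]) (colimBelow_comm (𝟙 X) x).symm

lemma latch_hom_ext {X Y : D ⥤ C} {φ : X ⟶ Y} {x : D} {Z : C} {f g : latch φ x ⟶ Z}
    (h₁ : ∀ (d : D) (hd : d < x), ιBelow Y hd ≫ pushout.inl _ _ ≫ f =
      ιBelow Y hd ≫ pushout.inl _ _ ≫ g)
    (h₂ : pushout.inr _ _ ≫ f = pushout.inr _ _ ≫ g) : f = g :=
  pushout.hom_ext (colimBelow_hom_ext fun d hd ↦ h₁ d hd) h₂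

end Latching

/-! ### Inductive construction of lifts -/

section Lifting

variable {D : Type w} [PartialOrder D] [Finite D] {C : Type u} [Category.{v} C]
  [HasFiniteColimits C]

/-- At a new element `x`, the lifts already built below `x` and the map `a` at `x` glue to a map out
of the pushout; lifting the mediating morphism against `p` extends it. Data on a lower set `V` only
are allowed so that both `D` and `Set.Iio x` can be treated. -/
lemma exists_lift_on_lowerSet {L R : MorphismProperty C}
    (hLR : ∀ ⦃A B X Y : C⦄ (i : A ⟶ B) (p : X ⟶ Y), L i → R p → HasLiftingProperty i p)
    {X Y A B : D ⥤ C} (φ : X ⟶ Y) (p : A ⟶ B) (V : Set D) (hV : IsLowerSet V)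
    (hφ : ∀ x ∈ V, L (mediating φ x)) (hp : ∀ x ∈ V, R (p.app x))
    (a : ∀ d ∈ V, X.obj d ⟶ A.obj d) (b : ∀ d ∈ V, Y.obj d ⟶ B.obj d)
    (ha : ∀ (d d' : D) (f : d ⟶ d') (hd : d ∈ V) (hd' : d' ∈ V),
      X.map f ≫ a d' hd' = a d hd ≫ A.map f)
    (hb : ∀ (d d' : D) (f : d ⟶ d') (hd : d ∈ V) (hd' : d' ∈ V),
      Y.map f ≫ b d' hd' = b d hd ≫ B.map f)
    (hab : ∀ d (hd : d ∈ V), a d hd ≫ p.app d = φ.app d ≫ b d hd) :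
    ∃ h : ∀ d ∈ V, Y.obj d ⟶ A.obj d,
      (∀ (d d' : D) (f : d ⟶ d') (hd : d ∈ V) (hd' : d' ∈ V),
        Y.map f ≫ h d' hd' = h d hd ≫ A.map f) ∧
      (∀ d (hd : d ∈ V), φ.app d ≫ h d hd = a d hd) ∧
      (∀ d (hd : d ∈ V), h d hd ≫ p.app d = b d hd) := by
  classical
  have := Fintype.ofFinite D
  suffices H : ∀ U : Finset D, IsLowerSet (U : Set D) → ∀ hUV : ∀ d ∈ U, d ∈ V,
      ∃ h : ∀ d ∈ U, Y.obj d ⟶ A.obj d,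
      (∀ (d d' : D) (f : d ⟶ d') (hd : d ∈ U) (hd' : d' ∈ U),
        Y.map f ≫ h d' hd' = h d hd ≫ A.map f) ∧
      (∀ d (hd : d ∈ U), φ.app d ≫ h d hd = a d (hUV d hd)) ∧
      (∀ d (hd : d ∈ U), h d hd ≫ p.app d = b d (hUV d hd)) by
    have hfil : ∀ d, d ∈ Finset.univ.filter (· ∈ V) ↔ d ∈ V := fun d ↦ by simp
    obtain ⟨h, h₁, h₂, h₃⟩ := H (Finset.univ.filter (· ∈ V))
      (by intro x y hyx hx; simp only [Finset.mem_coe, hfil] at hx ⊢; exact hV hyx hx)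
      (fun d hd ↦ (hfil d).1 hd)
    exact ⟨fun d hd ↦ h d ((hfil d).2 hd), fun d d' f hd hd' ↦ h₁ d d' f _ _,
      fun d hd ↦ h₂ d _, fun d hd ↦ h₃ d _⟩
  refine finset_lowerSet_induction ?_ ?_
  · intro _
    exact ⟨fun d hd ↦ by simp at hd, fun d d' f hd ↦ by simp at hd, fun d hd ↦ by simp at hd,
      fun d hd ↦ by simp at hd⟩
  · intro U x hU hxU hx ih hUV
    obtain ⟨h, h₁, h₂, h₃⟩ := ih fun d hd ↦ hUV d (Finset.mem_insert_of_mem hd)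
    have hxV : x ∈ V := hUV x (Finset.mem_insert_self _ _)
    obtain ⟨s, hs⟩ := colimBelow_exists_desc Y x (Z := A.obj x)
      (fun d hd ↦ h d (hx d hd) ≫ A.map (homOfLE hd.le))
      (fun d d' f hd' ↦ by
        rw [← Category.assoc, h₁ d d' f (hx _ ((leOfHom f).trans_lt hd')) (hx _ hd'),
          Category.assoc, ← A.map_comp]
        rfl)
    have hsa : colimBelowMap φ x ≫ s = colimBelowTo X x ≫ a x hxV := by
      refine colimBelow_hom_ext fun d hd ↦ ?_
      rw [ιBelow_colimBelowMap_assoc, hs, ιBelow_colimBelowTo_assoc, ← Category.assoc, h₂,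
        ha _ _ _ (hV hd.le hxV)]
    have sq : CommSq (pushout.desc s (a x hxV) hsa) (mediating φ x) (p.app x) (b x hxV) := by
      refine ⟨latch_hom_ext (fun d hd ↦ ?_) ?_⟩
      · rw [pushout.inl_desc_assoc, reassoc_of% (hs d hd), p.naturality, ← Category.assoc,
          h₃, inl_mediating_assoc, ιBelow_colimBelowTo_assoc, hb _ _ _ (hV hd.le hxV)]
      · rw [pushout.inr_desc_assoc, inr_mediating_assoc, hab]
    have := hLR _ _ (hφ x hxV) (hp x hxV)
    let l := sq.lift
    have hl : mediating φ x ≫ l = _ := sq.fac_left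
    have hl₀ : ∀ d (hd : d < x), Y.map (homOfLE hd.le) ≫ l =
        h d (hx d hd) ≫ A.map (homOfLE hd.le) := fun d hd ↦ by
      rw [← hs d hd, ← ιBelow_colimBelowTo_assoc Y hd, ← inl_mediating_assoc φ, hl, pushout.inl_desc]
    have hl₁ : φ.app x ≫ l = a x hxV := by
      rw [← inr_mediating_assoc, hl, pushout.inr_desc]
    have hl₂ : l ≫ p.app x = b x hxV := sq.fac_right
    have hmem : ∀ d ∈ insert x U, d ∉ U → d = x := fun d hd hdU ↦
      (Finset.mem_insert.1 hd).resolve_right hdU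
    -- Outside `U` one has `d = x`; composing with maps of `Y` and `A` between equal elements
    -- replaces a cast.
    refine ⟨fun d hd ↦ if hdU : d ∈ U then h d hdU else
      Y.map (homOfLE (hmem d hd hdU).le) ≫ l ≫ A.map (homOfLE (hmem d hd hdU).ge), ?_, ?_, ?_⟩
    · intro d d' f hd hd'
      by_cases hdU : d ∈ U <;> by_cases hdU' : d' ∈ U
      · simp only [hdU, hdU', dite_true]
        exact h₁ _ _ _ _ _
      · obtain rfl := hmem d' hd' hdU'
        simp only [hdU, hdU', dite_true, dite_false]
        have hlt : d < d' := lt_of_le_of_ne (leOfHom f) (fun e ↦ hdU' (e ▸ hdU))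
        have := hl₀ d hlt
        rw [show homOfLE hlt.le = f from rfl] at this
        simp [this]
      · exact (hdU (hU (leOfHom f) hdU')).elim
      · obtain rfl := hmem d hd hdU
        obtain rfl := hmem d' hd' hdU'
        obtain rfl : f = 𝟙 _ := rfl
        simp
    · intro d hd
      by_cases hdU : d ∈ U
      · simp only [hdU, dite_true, h₂]
      · obtain rfl := hmem d hd hdU
        simp [hdU, hl₁]
    · intro d hd
      by_cases hdU : d ∈ U
      · simp only [hdU, dite_true, h₃]
      · obtain rfl := hmem d hd hdU
        simp [hdU, hl₂]

end Lifting

/-! ### Inductive construction of factorizations -/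

section Factorization

variable {D : Type w} [PartialOrder D] [Finite D] {C : Type u} [Category.{v} C]
  [HasFiniteColimits C]

/-- A factorization of the mediating morphism of `c : X ⟶ W` at `d`. -/
structure LatchFactorization {X W : D ⥤ C} (c : X ⟶ W) (d : D) where
  /-- the intermediate object -/
  mid : C
  /-- the first morphism -/
  i : latch c d ⟶ mid
  /-- the second morphism -/
  p : mid ⟶ W.obj d
  fac : i ≫ p = mediating c d

attribute [simp] LatchFactorization.fac

@[simp]
lemma LatchFactorization.fac_assoc {X W : D ⥤ C} {c : X ⟶ W} {d : D}
    (T : LatchFactorization c d) {Z : C} (k : W.obj d ⟶ Z) :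
    T.i ≫ T.p ≫ k = mediating c d ≫ k := by
  rw [← Category.assoc, T.fac]

/-- The factorization of the mediating morphism whose second morphism is the identity. -/
@[simps]
noncomputable def LatchFactorization.trivial {X W : D ⥤ C} (c : X ⟶ W) (d : D) :
    LatchFactorization c d where
  mid := W.obj d
  i := mediating c d
  p := 𝟙 _
  fac := Category.comp_id _

variable {X W : D ⥤ C} {c : X ⟶ W} (T : ∀ d, LatchFactorization c d)

open Classical in
/-- The functor obtained from a target functor `W` by replacing its values with the intermediate
objects of factorizations of the mediating morphisms. -/
noncomputable abbrev replace : D ⥤ C where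
  obj d := (T d).mid
  -- Maps between distinct elements go back to `W` and through its latching object; composites agree
  -- because `i ≫ p` is the mediating morphism.
  map {d d'} f := if h : d = d' then eqToHom (by rw [h]) else
    (T d).p ≫ ιBelow W (lt_of_le_of_ne (leOfHom f) h) ≫ pushout.inl _ _ ≫ (T d').i
  map_id d := by simp
  map_comp {d d' d''} f g := by
    by_cases h : d = d'
    · subst h
      obtain rfl : f = 𝟙 _ := rfl
      simp
    · by_cases h' : d' = d''
      · subst h'
        obtain rfl : g = 𝟙 _ := rfl
        simp
      · have hlt := lt_of_le_of_ne (leOfHom f) h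
        have hlt' := lt_of_le_of_ne (leOfHom g) h'
        simp only [h, h', (hlt.trans hlt').ne, dite_false, Category.assoc,
          LatchFactorization.fac_assoc, inl_mediating_assoc, ιBelow_colimBelowTo_assoc,
          map_ιBelow_assoc]

lemma replace_map {d d' : D} (f : d ⟶ d') (h : d < d') :
    (replace T).map f = (T d).p ≫ ιBelow W h ≫ pushout.inl _ _ ≫ (T d').i :=
  dif_neg h.ne

/-- The canonical morphism to the original functor. -/
noncomputable def replaceTo : replace T ⟶ W where
  app d := (T d).p
  naturality d d' f := by
    by_cases h : d = d'
    · subst h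
      obtain rfl : f = 𝟙 _ := rfl
      rw [CategoryTheory.Functor.map_id, CategoryTheory.Functor.map_id, Category.comp_id]
      exact Category.id_comp _
    · have hlt := lt_of_le_of_ne (leOfHom f) h
      rw [replace_map T f hlt]
      change ((T d).p ≫ ιBelow W hlt ≫ pushout.inl _ _ ≫ (T d').i) ≫ (T d').p = (T d).p ≫ W.map f
      simp only [Category.assoc, LatchFactorization.fac, inl_mediating, ιBelow_colimBelowTo]
      rfl

/-- The canonical morphism from the original source. -/
noncomputable def toReplace : X ⟶ replace T where
  app d := pushout.inr _ _ ≫ (T d).i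
  naturality d d' f := by
    by_cases h : d = d'
    · subst h
      obtain rfl : f = 𝟙 _ := rfl
      simp
    · have hlt := lt_of_le_of_ne (leOfHom f) h
      rw [replace_map T f hlt]
      have : ιBelow X hlt ≫ colimBelowTo X d' = X.map f := ιBelow_colimBelowTo X hlt
      rw [← this]
      change _ = (pushout.inr _ _ ≫ (T d).i) ≫ (T d).p ≫ ιBelow W hlt ≫ pushout.inl _ _ ≫ (T d').i
      simp only [Category.assoc, LatchFactorization.fac_assoc, inr_mediating_assoc,
        ← pushout.condition_assoc, ιBelow_colimBelowMap_assoc]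

lemma toReplace_replaceTo : toReplace T ≫ replaceTo T = c := by
  ext d
  change (pushout.inr _ _ ≫ (T d).i) ≫ (T d).p = c.app d
  simp

lemma mediating_toReplace (d : D) : mediating (toReplace T) d =
    latchMap (toReplace T) c (𝟙 X) (replaceTo T)
      (by rw [toReplace_replaceTo, Category.id_comp]) d ≫ (T d).i := by
  refine latch_hom_ext (fun d' hd' ↦ ?_) ?_
  · have h₁ := ιBelow_colimBelowMap (replaceTo T) hd'
    rw [inl_mediating, ιBelow_colimBelowTo, replace_map T _ hd', inl_latchMap_assoc,
      reassoc_of% h₁]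
    rfl
  · rw [inr_mediating, inr_latchMap_assoc]
    exact (Category.id_comp _).symm

/-- `P` is kept general so that one induction yields both ordinary and minimal factorizations.
Keeping `p` invertible outside `U` allows the values of `Y` to be replaced one at a time. -/
lemma exists_factorization_of_latch (P : ∀ {A B E : C}, (A ⟶ B) → (B ⟶ E) → Prop)
    (hP : ∀ {A E : C} (f : A ⟶ E), ∃ (B : C) (i : A ⟶ B) (p : B ⟶ E), i ≫ p = f ∧ P i p)
    (hiso : ∀ {A' A B E : C} (e : A' ⟶ A) (i : A ⟶ B) (p : B ⟶ E), IsIso e → P i p →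
      P (e ≫ i) p)
    {X Y : D ⥤ C} (φ : X ⟶ Y) :
    ∃ (W : D ⥤ C) (c : X ⟶ W) (p : W ⟶ Y), c ≫ p = φ ∧
      ∀ d, P (mediating c d) (p.app d) := by
  classical
  have := Fintype.ofFinite D
  suffices H : ∀ U : Finset D, IsLowerSet (U : Set D) →
      ∃ (W : D ⥤ C) (c : X ⟶ W) (p : W ⟶ Y), c ≫ p = φ ∧
      (∀ d ∈ U, P (mediating c d) (p.app d)) ∧ (∀ d ∉ U, IsIso (p.app d)) by
    obtain ⟨W, c, p, h₁, h₂, -⟩ := H Finset.univ (by simpa using isLowerSet_univ)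
    exact ⟨W, c, p, h₁, fun d ↦ h₂ d (Finset.mem_univ d)⟩
  refine finset_lowerSet_induction ?_ ?_
  · exact ⟨Y, φ, 𝟙 Y, Category.comp_id _, by simp, fun d _ ↦ inferInstanceAs (IsIso (𝟙 (Y.obj d)))⟩
  · rintro U x hU hxU hx ⟨W, c, p, rfl, h₂, h₃⟩
    have := h₃ x hxU
    obtain ⟨F, i, r, hir, hF⟩ := hP (mediating c x ≫ p.app x)
    -- The map to `Y.obj x` was factored; as `p.app x` is invertible, this is also a factorization
    -- of the mediating morphism into `W.obj x`.
    let t : LatchFactorization c x := ⟨F, i, r ≫ inv (p.app x), by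
      rw [reassoc_of% hir, IsIso.hom_inv_id, Category.comp_id]⟩
    let T : ∀ d, LatchFactorization c d := Function.update (LatchFactorization.trivial c) x t
    have hTx : T x = t := Function.update_self _ _ _
    have hT : ∀ d, d ≠ x → T d = LatchFactorization.trivial c d := fun d hd ↦
      Function.update_of_ne hd _ _
    have hTiso : ∀ d, d ≠ x → IsIso (T d).p := fun d hd ↦ by
      rw [hT d hd]
      exact inferInstanceAs (IsIso (𝟙 (W.obj d)))
    -- No element of `insert x U` has `x` strictly below it, so the pushouts there change only by
    -- isomorphism.
    have key : ∀ d, (∀ d' < d, d' ≠ x) → P (T d).i ((T d).p ≫ p.app d) →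
        P (mediating (toReplace T) d) ((replaceTo T ≫ p).app d) := fun d hd h ↦ by
      rw [mediating_toReplace]
      exact hiso _ _ _ (isIso_latchMap_id _ _ _ _ _ fun d' hd' ↦ hTiso d' (hd d' hd')) h
    refine ⟨replace T, toReplace T, replaceTo T ≫ p, ?_, ?_, ?_⟩
    · rw [← Category.assoc, toReplace_replaceTo]
    · intro d hd
      rcases Finset.mem_insert.1 hd with rfl | hdU
      · refine key _ (fun d' hd' ↦ hd'.ne) ?_
        rw [hTx]
        simpa [t] using hF
      · have hne : ∀ d' ≤ d, d' ≠ x := fun d' hd' e ↦ hxU (e ▸ hU hd' hdU)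
        refine key _ (fun d' hd' ↦ hne d' hd'.le) ?_
        rw [hT d (hne d le_rfl)]
        have e : (LatchFactorization.trivial c d).p ≫ p.app d = p.app d := Category.id_comp _
        rw [e]
        exact h₂ d hdU
    · intro d hd
      have hne : d ≠ x := fun e ↦ hd (e ▸ Finset.mem_insert_self _ _)
      have := hTiso d hne
      have := h₃ d fun h ↦ hd (Finset.mem_insert_of_mem h)
      exact inferInstanceAs (IsIso ((T d).p ≫ p.app d))

end Factorization

/-! ### The induced weak factorization system over a finite poset -/

section WeakFactorizationSystem

variable {D : Type w} [PartialOrder D] {C : Type u} [Category.{v} C]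

/-- The morphisms of functors which are objectwise in `R`. -/
def objectwise (R : MorphismProperty C) : MorphismProperty (D ⥤ C) :=
  fun _ _ φ ↦ ∀ x, R (φ.app x)

variable [Finite D] [HasFiniteColimits C]

/-- The morphisms of functors all of whose mediating morphisms are in `L`. -/
def latching (L : MorphismProperty C) : MorphismProperty (D ⥤ C) :=
  fun _ _ φ ↦ ∀ x, L (mediating φ x)

variable {L : MorphismProperty C} (R : MorphismProperty C) [L.IsWeakFactorizationSystem R]

lemma hasLiftingProperty_of_latching {X Y A B : D ⥤ C} (φ : X ⟶ Y) (p : A ⟶ B)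
    (hφ : latching L φ) (hp : objectwise R p) : HasLiftingProperty φ p where
  sq_hasLift {a b} sq := by
    obtain ⟨h, h₁, h₂, h₃⟩ := exists_lift_on_lowerSet (L := L) (R := R)
      (fun _ _ _ _ i p hi hp ↦ MorphismProperty.hasLiftingProperty_of_wfs i p hi hp)
      φ p Set.univ isLowerSet_univ (fun x _ ↦ hφ x) (fun x _ ↦ hp x)
      (fun d _ ↦ a.app d) (fun d _ ↦ b.app d) (fun _ _ f _ _ ↦ a.naturality f)
      (fun _ _ f _ _ ↦ b.naturality f) (fun d _ ↦ NatTrans.congr_app sq.w d)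
    exact ⟨⟨{ l := { app := fun d ↦ h d trivial, naturality := fun d d' f ↦ h₁ d d' f _ _ }
              fac_left := by ext d; exact h₂ d trivial
              fac_right := by ext d; exact h₃ d trivial }⟩⟩

instance objectwise_isStableUnderRetracts (R : MorphismProperty C) [R.IsStableUnderRetracts] :
    (objectwise R : MorphismProperty (D ⥤ C)).IsStableUnderRetracts where
  of_retract h hg x :=
    R.of_retract (h.map ((evaluation D C).obj x)) (hg x)

/-- The mediating morphisms of a retract are retracts. -/
noncomputable def mediatingRetract {X Y X' Y' : D ⥤ C} {f : X ⟶ Y} {g : X' ⟶ Y'}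
    (h : RetractArrow f g) (x : D) : RetractArrow (mediating f x) (mediating g x) where
  i := Arrow.homMk (latchMap f g h.i.left h.i.right h.i.w x) (h.i.right.app x)
    (latchMap_mediating _ _ _ _ _ _)
  r := Arrow.homMk (latchMap g f h.r.left h.r.right h.r.w x) (h.r.right.app x)
    (latchMap_mediating _ _ _ _ _ _)
  retract := by
    have hl : h.i.left ≫ h.r.left = 𝟙 _ := congrArg CommaMorphism.left h.retract
    have hr : h.i.right ≫ h.r.right = 𝟙 _ := congrArg CommaMorphism.right h.retract
    have hl' := NatTrans.congr_app hl x
    have hr' := NatTrans.congr_app hr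
    simp only [NatTrans.comp_app, NatTrans.id_app] at hl' hr'
    ext
    · refine latch_hom_ext (fun d hd ↦ ?_) ?_
      · simp [reassoc_of% (hr' d)]
      · simp [reassoc_of% hl']
    · exact hr' x

instance latching_isStableUnderRetracts (L : MorphismProperty C) [L.IsStableUnderRetracts] :
    (latching L : MorphismProperty (D ⥤ C)).IsStableUnderRetracts where
  of_retract h hg x := L.of_retract (mediatingRetract h x) (hg x)

variable (L) in
instance latching_objectwise_isWeakFactorizationSystem :
    (latching L : MorphismProperty (D ⥤ C)).IsWeakFactorizationSystem (objectwise R) := by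
  have : L.IsStableUnderRetracts := by
    rw [← MorphismProperty.llp_eq_of_wfs L R]; infer_instance
  have : R.IsStableUnderRetracts := by
    rw [← MorphismProperty.rlp_eq_of_wfs L R]; infer_instance
  have : L.RespectsIso := inferInstance
  have : MorphismProperty.HasFactorization (latching L : MorphismProperty (D ⥤ C))
      (objectwise R) := ⟨fun {X Y} φ ↦ by
    obtain ⟨W, c, p, hcp, h⟩ := exists_factorization_of_latch (fun i p ↦ L i ∧ R p)
      (fun f ↦ by
        have h := MorphismProperty.factorizationData L R f
        exact ⟨h.Z, h.i, h.p, h.fac, h.hi, h.hp⟩)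
      (fun e i p he h ↦ ⟨(L.cancel_left_of_respectsIso e i).2 h.1, h.2⟩) φ
    exact ⟨⟨W, c, p, hcp, fun d ↦ (h d).1, fun d ↦ (h d).2⟩⟩⟩
  exact .mk' _ _ fun i p hi hp ↦ hasLiftingProperty_of_latching R i p hi hp

/-- `φ.app x` is a cobase change of `colimBelowMap φ x` followed by a mediating morphism. The former
is in `L` because lifting it against `p` amounts to lifting `φ`, below `x`, against the constant
transformation `p`. -/
lemma objectwise_of_latching (R : MorphismProperty C) [L.IsWeakFactorizationSystem R]
    {X Y : D ⥤ C} (φ : X ⟶ Y) (hφ : latching L φ) : objectwise L φ := by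
  intro x
  have hc : L (colimBelowMap φ x) := by
    rw [← MorphismProperty.llp_eq_of_wfs L R]
    refine fun A B p hp ↦ ⟨fun {a b} sq ↦ ?_⟩
    obtain ⟨h, h₁, h₂, h₃⟩ := exists_lift_on_lowerSet (L := L) (R := R)
      (fun _ _ _ _ i p hi hp ↦ MorphismProperty.hasLiftingProperty_of_wfs i p hi hp)
      φ ((Functor.const D).map p) (Set.Iio x) (isLowerSet_Iio x) (fun x _ ↦ hφ x) (fun x _ ↦ hp)
      (fun d hd ↦ ιBelow X hd ≫ a) (fun d hd ↦ ιBelow Y hd ≫ b)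
      (fun _ _ f _ hd' ↦ (map_ιBelow_assoc X f hd' a).trans (Category.comp_id _).symm)
      (fun _ _ f _ hd' ↦ (map_ιBelow_assoc Y f hd' b).trans (Category.comp_id _).symm)
      (fun d hd ↦ by
        rw [← ιBelow_colimBelowMap_assoc φ hd, ← sq.w]
        exact Category.assoc _ _ _)
    obtain ⟨l, hl⟩ := colimBelow_exists_desc Y x h fun d d' f hd' ↦ by
      simpa using h₁ d d' f ((leOfHom f).trans_lt hd') hd'
    exact ⟨⟨{ l := l
              fac_left := colimBelow_hom_ext fun d hd ↦ by
                rw [ιBelow_colimBelowMap_assoc, hl]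
                exact h₂ d hd
              fac_right := colimBelow_hom_ext fun d hd ↦ by
                rw [reassoc_of% (hl d hd)]
                exact h₃ d hd }⟩⟩
  have hL : L.IsStableUnderCobaseChange ∧ L.IsStableUnderComposition := by
    rw [← MorphismProperty.llp_eq_of_wfs L R]
    exact ⟨inferInstance, inferInstance⟩
  have := hL.1
  have := hL.2
  rw [← inr_mediating]
  exact L.comp_mem _ _ (MorphismProperty.pushout_inr _ _ hc) (hφ x)

end WeakFactorizationSystem

/-! ### Minimal factorizations over a finite poset -/

section Minimality

/-- A lift over the inverse of `β`, composed with `ψ` on either side, is an endomorphism of the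
factorization, hence invertible. The automorphism `β` will be the one `ψ` induces on a pushout. -/
lemma isIso_of_isMinimalFactorization {C : Type u} [Category.{v} C] {A W Y : C} {m : A ⟶ W} {p : W ⟶ Y}
    (hmin : IsMinimalFactorization m p) [HasLiftingProperty m p] (β : A ⟶ A) [IsIso β]
    (ψ : W ⟶ W) (h₁ : m ≫ ψ = β ≫ m) (h₂ : ψ ≫ p = p) : IsIso ψ := by
  have sq : CommSq (inv β ≫ m) m p p := ⟨by
    rw [Category.assoc, IsIso.inv_comp_eq, ← reassoc_of% h₁, h₂]⟩
  have e₁ : IsIso (ψ ≫ sq.lift) := hmin _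
    (by rw [reassoc_of% h₁, sq.fac_left, IsIso.hom_inv_id_assoc])
    (by rw [Category.assoc, sq.fac_right, h₂])
  have e₂ : IsIso (sq.lift ≫ ψ) := hmin _
    (by rw [sq.fac_left_assoc, Category.assoc, h₁, IsIso.inv_hom_id_assoc])
    (by rw [Category.assoc, h₂, sq.fac_right])
  have : IsSplitMono ψ := ⟨⟨⟨sq.lift ≫ inv (ψ ≫ sq.lift), by
    rw [← Category.assoc, IsIso.hom_inv_id]⟩⟩⟩
  have : Epi ψ := epi_of_epi sq.lift ψ
  exact isIso_of_epi_of_isSplitMono ψ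

variable {D : Type w} [PartialOrder D] [Finite D] {C : Type u} [Category.{v} C]
  [HasFiniteColimits C]

/-- By well-founded induction: once `ψ` is invertible below `x`, it induces an automorphism of the
pushout at `x`, compatible with `ψ.app x`. -/
lemma isMinimalFactorization_of_mediating {X W Y : D ⥤ C} (c : X ⟶ W) (p : W ⟶ Y)
    (hlift : ∀ x, HasLiftingProperty (mediating c x) (p.app x))
    (hmin : ∀ x, IsMinimalFactorization (mediating c x) (p.app x)) :
    IsMinimalFactorization c p := by
  intro ψ h₁ h₂
  have : ∀ x, IsIso (ψ.app x) := by
    intro x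
    induction x using (Finite.wellFounded_of_trans_of_irrefl (α := D) (· < ·)).induction with
    | _ x ih =>
      have h : 𝟙 X ≫ c = c ≫ ψ := by rw [Category.id_comp, h₁]
      have := isIso_latchMap_id c c ψ h x ih
      have := hlift x
      exact isIso_of_isMinimalFactorization (hmin x) (latchMap c c (𝟙 X) ψ h x) _
        (latchMap_mediating _ _ _ _ _ _).symm (NatTrans.congr_app h₂ x)
  exact NatIso.isIso_of_isIso_app ψ

lemma exists_isMinimalFactorization_functor [ModelCategory C]
    (h : MinimalCofibrantFactorizationAxiom C) {X Y : D ⥤ C} (φ : X ⟶ Y) :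
    ∃ (W : D ⥤ C) (c : X ⟶ W) (p : W ⟶ Y), c ≫ p = φ ∧ latching (cofibrations C) c ∧
      objectwise (trivialFibrations C) p ∧ IsMinimalFactorization c p := by
  obtain ⟨W, c, p, hcp, H⟩ := exists_factorization_of_latch
    (fun i p ↦ cofibrations C i ∧ trivialFibrations C p ∧ IsMinimalFactorization i p)
    (fun f ↦ by
      obtain ⟨W, c, p, h₁, h₂, h₃, h₄, h₅⟩ := h f
      exact ⟨W, c, p, h₁, mem_cofibrations c, mem_trivialFibrations p, h₅⟩)
    (fun e i p he h ↦ ⟨((cofibrations C).cancel_left_of_respectsIso e i).2 h.1, h.2.1,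
      fun ψ h₁ h₂ ↦ h.2.2 ψ (by simpa [cancel_epi] using h₁) h₂⟩) φ
  exact ⟨W, c, p, hcp, fun d ↦ (H d).1, fun d ↦ (H d).2.1,
    isMinimalFactorization_of_mediating c p
      (fun d ↦ MorphismProperty.hasLiftingProperty_of_wfs _ _ (H d).1 (H d).2.1)
      (fun d ↦ (H d).2.2)⟩

end Minimality

/-! ### Tame functors as functors generated by a finite subset -/

section Discretization

variable {Q : Type w} [PartialOrder Q] {D : Type w} [PartialOrder D]
  {C : Type u} [Category.{v} C]

instance hasColimitsOfShape_costructuredArrow [Finite D] [HasFiniteColimits C] (α : D →o Q) (q : Q) :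
    HasColimitsOfShape (CostructuredArrow α.monotone.functor q) C := by
  have : Fintype D := Fintype.ofFinite D
  have : Finite (CostructuredArrow α.monotone.functor q) :=
    Finite.of_injective (fun g ↦ g.left) fun g g' hgg ↦ by
      obtain ⟨a, b, f⟩ := g
      obtain ⟨a', b', f'⟩ := g'
      obtain rfl : a = a' := hgg
      obtain rfl : b = b' := Subsingleton.elim _ _
      obtain rfl : f = f' := Subsingleton.elim _ _
      rfl
  have : Fintype (CostructuredArrow α.monotone.functor q) := Fintype.ofFinite _
  have : Quiver.IsThin (CostructuredArrow α.monotone.functor q) := fun g g' ↦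
    ⟨fun a b ↦ CostructuredArrow.hom_ext _ _ (Subsingleton.elim _ _)⟩
  exact hasColimitsOfShape_of_hasFiniteColimits C _

lemma existsUnique_of_isLeftKanExtension [Finite D] [HasFiniteColimits C] {α : D →o Q} {X : Q ⥤ C}
    {Y : D ⥤ C} (η : Y ⟶ α.monotone.functor ⋙ X) [X.IsLeftKanExtension η]
    (e : ∀ d, Y.obj d ⟶ X.obj (α d)) (he : ∀ d, e d = η.app d) (q : Q) (Z : C) (k : ∀ d, α d ≤ q → (Y.obj d ⟶ Z))
    (hk : ∀ (d d' : D) (f : d ⟶ d') (hd : α d ≤ q) (hd' : α d' ≤ q),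
      Y.map f ≫ k d' hd' = k d hd) :
    ∃! l : X.obj q ⟶ Z, ∀ d (hd : α d ≤ q), e d ≫ X.map (homOfLE hd) ≫ l = k d hd := by
  obtain rfl : e = η.app := funext he
  have hp := Functor.isPointwiseLeftKanExtensionOfIsLeftKanExtension X η
  let c : Cocone (CostructuredArrow.proj α.monotone.functor q ⋙ Y) :=
    { pt := Z
      ι := { app := fun g ↦ k g.left (leOfHom g.hom)
             naturality := fun g g' f ↦
              (hk _ _ f.left (leOfHom g.hom) (leOfHom g'.hom)).trans (Category.comp_id _).symm } }
  refine ⟨(hp q).desc c, fun d hd ↦ ?_, fun l hl ↦ ?_⟩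
  · have := (hp q).fac c (CostructuredArrow.mk (Y := d) (homOfLE hd : α.monotone.functor.obj d ⟶ q))
    exact (Category.assoc _ _ _).symm.trans this
  · refine (hp q).hom_ext fun g ↦ ?_
    rw [(hp q).fac]
    exact (Category.assoc _ _ _).trans (hl g.left (leOfHom g.hom))

/-- The values of `X` are the colimits of its values at the smaller elements of `S`. -/
def IsGeneratedBy (S : Finset Q) (X : Q ⥤ C) : Prop :=
  ∀ (q : Q) (Z : C) (k : ∀ s ∈ S, s ≤ q → (X.obj s ⟶ Z)),
    (∀ (s s' : Q) (f : s ⟶ s') (hs : s ∈ S) (hs' : s' ∈ S) (hsq : s ≤ q) (hsq' : s' ≤ q),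
      X.map f ≫ k s' hs' hsq' = k s hs hsq) →
    ∃! l : X.obj q ⟶ Z, ∀ s (hs : s ∈ S) (hsq : s ≤ q), X.map (homOfLE hsq) ≫ l = k s hs hsq

lemma IsGeneratedBy.hom_ext {S : Finset Q} {X : Q ⥤ C} (h : IsGeneratedBy S X) {q : Q} {Z : C}
    {f g : X.obj q ⟶ Z}
    (hfg : ∀ s ∈ S, ∀ hsq : s ≤ q, X.map (homOfLE hsq) ≫ f = X.map (homOfLE hsq) ≫ g) :
    f = g :=
  (h q Z (fun _ _ hsq ↦ X.map (homOfLE hsq) ≫ g)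
    (fun s s' f _ _ _ _ ↦ by rw [← Category.assoc, ← X.map_comp]; rfl)).unique hfg
    (fun _ _ _ ↦ rfl)

/-- Each structure map from `Y.obj d` factors through `X.obj (α d)`, and `α d ∈ S`. Hence `α` may be
traded for the inclusion of its image, or of any larger finite set. -/
lemma Discretizes.isGeneratedBy [Finite D] [HasFiniteColimits C] {α : D →o Q} {X : Q ⥤ C}
    (h : Discretizes α X) {S : Finset Q} (hS : ∀ d, α d ∈ S) : IsGeneratedBy S X := by
  obtain ⟨Y, η, h⟩ := h
  obtain ⟨e, he⟩ : ∃ e : ∀ d, Y.obj d ⟶ X.obj (α d), ∀ d, e d = η.app d := ⟨_, fun _ ↦ rfl⟩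
  have H := existsUnique_of_isLeftKanExtension η e he
  have hη : ∀ (d d' : D) (f : d ⟶ d'), Y.map f ≫ e d' =
      e d ≫ X.map (homOfLE (α.monotone (leOfHom f))) := fun d d' f ↦ by
    rw [he, he]
    exact η.naturality f
  have hext : ∀ {q : Q} {Z : C} {f g : X.obj q ⟶ Z}, (∀ d (hd : α d ≤ q),
      e d ≫ X.map (homOfLE hd) ≫ f = e d ≫ X.map (homOfLE hd) ≫ g) → f = g := by
    intro q Z f g hfg
    refine (H q Z (fun d hd ↦ e d ≫ X.map (homOfLE hd) ≫ g) fun d d' u hd hd' ↦ ?_).unique hfg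
      (fun _ _ ↦ rfl)
    rw [reassoc_of% hη d d' u, ← X.map_comp_assoc]
    rfl
  intro q Z k hk
  obtain ⟨l, hl, -⟩ := H q Z (fun d hd ↦ e d ≫ k (α d) (hS d) hd) fun d d' u hd hd' ↦ by
    rw [reassoc_of% hη d d' u, hk _ _ _ (hS d) (hS d') hd hd']
  refine ⟨l, fun s hs hsq ↦ hext fun d hd ↦ ?_, fun l' hl' ↦ hext fun d hd ↦ ?_⟩
  · rw [← X.map_comp_assoc, hk _ _ (homOfLE hd) (hS d) hs (hd.trans hsq) hsq]
    exact hl d (hd.trans hsq)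
  · rw [hl' _ (hS d)]
    exact (hl d hd).symm

/-- The restriction of a functor to a finite full subposet. -/
abbrev restrict (S : Finset Q) (X : Q ⥤ C) : {q : Q // q ∈ S} ⥤ C :=
  (finiteInclusion S).monotone.functor ⋙ X

/-- Together with `IsGeneratedBy.nat_hom_ext`, this makes restriction to `S` bijective on morphisms
out of a generated functor. -/
lemma IsGeneratedBy.exists_extension {S : Finset Q} {X : Q ⥤ C} (h : IsGeneratedBy S X)
    {A : Q ⥤ C} (f : restrict S X ⟶ restrict S A) :
    ∃ F : X ⟶ A, Functor.whiskerLeft (finiteInclusion S).monotone.functor F = f := by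
  obtain ⟨k, hk⟩ : ∃ k : ∀ s ∈ S, X.obj s ⟶ A.obj s, ∀ s hs, k s hs = f.app ⟨s, hs⟩ :=
    ⟨_, fun _ _ ↦ rfl⟩
  have hnat : ∀ (s s' : Q) (g : s ⟶ s') (hs : s ∈ S) (hs' : s' ∈ S),
      X.map g ≫ k s' hs' = k s hs ≫ A.map g := fun s s' g hs hs' ↦ by
    rw [hk, hk]
    exact f.naturality (X := ⟨s, hs⟩) (Y := ⟨s', hs'⟩) (homOfLE (leOfHom g))
  have H := fun q ↦ h q (A.obj q) (fun s hs hsq ↦ k s hs ≫ A.map (homOfLE hsq))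
    fun s s' g hs hs' hsq hsq' ↦ by
      rw [reassoc_of% hnat s s' g hs hs', ← A.map_comp]
      rfl
  choose l hl _ using H
  refine ⟨{ app := l, naturality := fun q q' g ↦ h.hom_ext fun s hs hsq ↦ ?_ }, ?_⟩
  · rw [reassoc_of% hl q s hs hsq, ← X.map_comp_assoc, ← A.map_comp]
    exact hl q' s hs (hsq.trans (leOfHom g))
  · ext s
    have := hl s.1 s.1 s.2 le_rfl
    have e : homOfLE (le_refl s.1) = 𝟙 s.1 := rfl
    rw [e, X.map_id, A.map_id, Category.id_comp, Category.comp_id, hk] at this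
    exact this

lemma IsGeneratedBy.nat_hom_ext {S : Finset Q} {X : Q ⥤ C} (h : IsGeneratedBy S X)
    {A : Q ⥤ C} {F G : X ⟶ A} (hFG : ∀ s ∈ S, F.app s = G.app s) : F = G := by
  ext q
  refine h.hom_ext fun s hs hsq ↦ ?_
  rw [F.naturality, G.naturality, hFG s hs]

lemma IsGeneratedBy.discretizes {S : Finset Q} {X : Q ⥤ C} (h : IsGeneratedBy S X) :
    Discretizes (finiteInclusion S) X := by
  refine ⟨restrict S X, 𝟙 _, ⟨⟨IsInitial.ofUniqueHom
    (fun E ↦ StructuredArrow.homMk (h.exists_extension E.hom).choose ?_) fun E m ↦ ?_⟩⟩⟩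
  · exact (Category.id_comp _).trans (h.exists_extension E.hom).choose_spec
  · apply StructuredArrow.hom_ext
    refine h.nat_hom_ext fun s hs ↦ ?_
    have e₁ := (Category.id_comp _).symm.trans (StructuredArrow.w m)
    exact (NatTrans.congr_app e₁ ⟨s, hs⟩).trans
      (NatTrans.congr_app (h.exists_extension E.hom).choose_spec.symm ⟨s, hs⟩)

/-- Colimits of functors are computed objectwise and commute with the colimits expressing
generation. -/
lemma isGeneratedBy_of_isColimit {S : Finset Q} {J : Type*} [Category* J]
    [HasColimitsOfShape J C] {F : J ⥤ Q ⥤ C} {c : Cocone F} (hc : IsColimit c)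
    (hF : ∀ j, IsGeneratedBy S (F.obj j)) : IsGeneratedBy S c.pt := by
  intro q Z k hk
  have hq := fun q ↦ isColimitOfPreserves ((evaluation Q C).obj q) hc
  have hι : ∀ j {q q' : Q} (f : q ⟶ q'), (c.ι.app j).app q ≫ c.pt.map f =
      (F.obj j).map f ≫ (c.ι.app j).app q' := fun j q q' f ↦ ((c.ι.app j).naturality f).symm
  have H := fun j ↦ hF j q Z (fun s hs hsq ↦ (c.ι.app j).app s ≫ k s hs hsq)
    fun s s' f hs hs' hsq hsq' ↦ by
      rw [← reassoc_of% hι j f, hk]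
  choose l hl _ using H
  let e : Cocone (F ⋙ (evaluation Q C).obj q) :=
    { pt := Z
      ι := { app := l
             naturality := fun j j' g ↦ by
              refine (hF j).hom_ext fun s hs hsq ↦ ?_
              have h₁ : (F.map g).app s ≫ (c.ι.app j').app s = (c.ι.app j).app s :=
                NatTrans.congr_app (c.w g) s
              have h₂ : (F.obj j).map (homOfLE hsq) ≫ (F.map g).app q ≫ l j' = 
                  (F.map g).app s ≫ (F.obj j').map (homOfLE hsq) ≫ l j' := by
                rw [(F.map g).naturality_assoc]
              have h₃ := hl j s hs hsq
              rw [← h₁, Category.assoc, ← hl j', ← h₂] at h₃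
              exact h₃.symm.trans (by simp) } }
  have fac : ∀ j, (c.ι.app j).app q ≫ (hq q).desc e = l j := (hq q).fac e
  refine ⟨(hq q).desc e, fun s hs hsq ↦ (hq s).hom_ext fun j ↦ ?_, fun m hm ↦
    (hq q).hom_ext fun j ↦ (hF j).hom_ext fun s hs hsq ↦ ?_⟩
  · have := hι j (homOfLE hsq)
    change (c.ι.app j).app s ≫ c.pt.map (homOfLE hsq) ≫ (hq q).desc e =
      (c.ι.app j).app s ≫ k s hs hsq
    rw [reassoc_of% this, fac, hl]
  · have := hι j (homOfLE hsq)
    change (F.obj j).map _ ≫ (c.ι.app j).app q ≫ m =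
      (F.obj j).map _ ≫ (c.ι.app j).app q ≫ (hq q).desc e
    rw [fac, hl, ← reassoc_of% this, hm s hs hsq]

variable [HasFiniteColimits C]

lemma discretizes_finiteInclusion_iff (S : Finset Q) (X : Q ⥤ C) :
    Discretizes (finiteInclusion S) X ↔ IsGeneratedBy S X :=
  ⟨fun h ↦ h.isGeneratedBy fun d ↦ d.2, fun h ↦ h.discretizes⟩

lemma IsGeneratedBy.mono {S T : Finset Q} {X : Q ⥤ C} (h : IsGeneratedBy S X) (hST : S ⊆ T) :
    IsGeneratedBy T X :=
  h.discretizes.isGeneratedBy fun d ↦ hST d.2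

lemma isTame_iff (X : Q ⥤ C) : isTame Q C X ↔ ∃ S : Finset Q, IsGeneratedBy S X := by
  classical
  constructor
  · rintro ⟨D, _, _, α, h⟩
    have : Fintype D := Fintype.ofFinite D
    exact ⟨Finset.univ.image α, h.isGeneratedBy fun d ↦ Finset.mem_image_of_mem _ (Finset.mem_univ d)⟩
  · rintro ⟨S, h⟩
    exact ⟨_, _, inferInstance, _, h.discretizes⟩

lemma exists_isGeneratedBy_of_finite {ι : Type*} [Finite ι] (X : ι → Q ⥤ C)
    (hX : ∀ i, isTame Q C (X i)) (S₀ : Finset Q) :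
    ∃ S : Finset Q, S₀ ⊆ S ∧ ∀ i, IsGeneratedBy S (X i) := by
  classical
  have : Fintype ι := Fintype.ofFinite ι
  choose S hS using fun i ↦ (isTame_iff _).1 (hX i)
  exact ⟨S₀ ∪ Finset.univ.biUnion S, Finset.subset_union_left, fun i ↦ (hS i).mono
    ((Finset.subset_biUnion_of_mem S (Finset.mem_univ i)).trans Finset.subset_union_right)⟩

lemma exists_isGeneratedBy_pair {X Y : Q ⥤ C} (hX : isTame Q C X) (hY : isTame Q C Y)
    (S₀ : Finset Q) : ∃ S : Finset Q, S₀ ⊆ S ∧ IsGeneratedBy S X ∧ IsGeneratedBy S Y := by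
  obtain ⟨S, h₀, h⟩ := exists_isGeneratedBy_of_finite (fun b : Bool ↦ cond b X Y)
    (by rintro (_ | _) <;> assumption) S₀
  exact ⟨S, h₀, h true, h false⟩

lemma exists_isGeneratedBy_extension (S : Finset Q) (W : {q : Q // q ∈ S} ⥤ C) :
    ∃ X : Q ⥤ C, IsGeneratedBy S X ∧ Nonempty (W ≅ restrict S X) := by
  let L := (finiteInclusion S).monotone.functor
  -- The inclusion is fully faithful, so the unit of the left Kan extension is invertible.
  have : L.Full := ⟨fun f ↦ ⟨homOfLE (leOfHom f), Subsingleton.elim _ _⟩⟩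
  have : L.Faithful := ⟨fun _ ↦ Subsingleton.elim _ _⟩
  have h : IsIso (L.pointwiseLeftKanExtensionUnit W) :=
    (L.pointwiseLeftKanExtensionIsPointwiseLeftKanExtension W).isIso_hom
  exact ⟨L.pointwiseLeftKanExtension W, (discretizes_finiteInclusion_iff S _).1
    ⟨W, L.pointwiseLeftKanExtensionUnit W, inferInstance⟩,
    ⟨asIso (L.pointwiseLeftKanExtensionUnit W)⟩⟩

end Discretization

/-! ### Floors and the propagation of objectwise properties -/

section Floors

variable {Q : Type w} [PartialOrder Q] {C : Type u} [Category.{v} C]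

/-- Every element of `Q` which is above some element of `S` is above a greatest element of `S`. -/
def HasFloors (S : Finset Q) : Prop :=
  ∀ q : Q, (∃ s ∈ S, s ≤ q) → ∃ m ∈ S, m ≤ q ∧ ∀ s ∈ S, s ≤ q → s ≤ m

variable (Q C) in
/-- Every tame functor is generated by a finite subset which has floors. -/
def HasFlooredGenerators : Prop :=
  ∀ X : Q ⥤ C, isTame Q C X → ∃ S : Finset Q, HasFloors S ∧ IsGeneratedBy S X

/-- When some `α d ≤ q`, the adjoint value `t q` is the largest such `d`, and its image is the floor
of `q`. -/
lemma AdmitsTransfer.hasFloors {D : Type w} [PartialOrder D] {α : D →o Q} (h : AdmitsTransfer α)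
    {S : Finset Q} (hS : ∀ q, q ∈ S ↔ ∃ d, α d = q) : HasFloors S := by
  obtain ⟨t, ht⟩ := h
  have ht' : ∀ (d : D) (q : Q), α d ≤ q ↔ (d : WithBot D) ≤ t q := fun d q ↦ by
    rw [← ht, OrderHom.withBotMap_coe, WithBot.map_coe, WithBot.coe_le_coe]
  rintro q ⟨s, hs, hsq⟩
  obtain ⟨d, rfl⟩ := (hS _).1 hs
  have hd := (ht' d q).1 hsq
  obtain ⟨e, he⟩ := WithBot.ne_bot_iff_exists.1 (ne_bot_of_le_ne_bot WithBot.coe_ne_bot hd)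
  refine ⟨α e, (hS _).2 ⟨e, rfl⟩, (ht' e q).2 he.le, ?_⟩
  intro s hs hsq
  obtain ⟨d, rfl⟩ := (hS _).1 hs
  have := (ht' d q).1 hsq
  rw [← he, WithBot.coe_le_coe] at this
  exact α.monotone this

lemma IsGeneratedBy.isIso_map {S : Finset Q} {X : Q ⥤ C} (h : IsGeneratedBy S X) {m q : Q}
    (hmq : m ≤ q) (hm : m ∈ S) (hmax : ∀ s ∈ S, s ≤ q → s ≤ m) : IsIso (X.map (homOfLE hmq)) := by
  obtain ⟨l, hl, -⟩ := h q (X.obj m) (fun s hs hsq ↦ X.map (homOfLE (hmax s hs hsq)))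
    fun s s' f hs hs' hsq hsq' ↦ by rw [← X.map_comp]; rfl
  refine ⟨l, (hl m hm hmq).trans (X.map_id _), h.hom_ext fun s hs hsq ↦ ?_⟩
  rw [reassoc_of% hl s hs hsq, ← X.map_comp, Category.comp_id]
  rfl

lemma IsGeneratedBy.isInitial {S : Finset Q} {X : Q ⥤ C} (h : IsGeneratedBy S X) {q : Q}
    (hq : ∀ s ∈ S, ¬ s ≤ q) : Nonempty (IsInitial (X.obj q)) := by
  have H := fun Z ↦ h q Z (fun s hs hsq ↦ (hq s hs hsq).elim)
    fun s _ _ hs _ hsq _ ↦ (hq s hs hsq).elim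
  choose l hl _ using H
  exact ⟨IsInitial.ofUniqueHom l fun Z m ↦ h.hom_ext fun s hs hsq ↦ (hq s hs hsq).elim⟩

lemma HasFloors.isGeneratedBy {S : Finset Q} (hS : HasFloors S) {X : Q ⥤ C}
    (h₁ : ∀ (m q : Q) (hmq : m ≤ q), m ∈ S → (∀ s ∈ S, s ≤ q → s ≤ m) →
      IsIso (X.map (homOfLE hmq)))
    (h₂ : ∀ q, (∀ s ∈ S, ¬ s ≤ q) → Nonempty (IsInitial (X.obj q))) : IsGeneratedBy S X := by
  intro q Z k hk
  by_cases hq : ∃ s ∈ S, s ≤ q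
  · obtain ⟨m, hm, hmq, hmax⟩ := hS q hq
    have := h₁ m q hmq hm hmax
    refine ⟨inv (X.map (homOfLE hmq)) ≫ k m hm hmq, fun s hs hsq ↦ ?_, fun l hl ↦ ?_⟩
    · have e : X.map (homOfLE hsq) = X.map (homOfLE (hmax s hs hsq)) ≫ X.map (homOfLE hmq) := by
        rw [← X.map_comp]; rfl
      rw [e, Category.assoc, IsIso.hom_inv_id_assoc, hk _ _ _ hs hm hsq hmq]
    · rw [← hl m hm hmq, IsIso.inv_hom_id_assoc]
  · push Not at hq
    obtain ⟨h⟩ := h₂ q hq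
    exact ⟨h.to Z, fun s hs hsq ↦ (hq s hs hsq).elim, fun l _ ↦ h.hom_ext _ _⟩

lemma HasFloors.objectwise {S : Finset Q} (hS : HasFloors S) {X Y : Q ⥤ C}
    (hX : IsGeneratedBy S X) (hY : IsGeneratedBy S Y) (R : MorphismProperty C)
    [R.RespectsIso] [R.ContainsIdentities] (p : X ⟶ Y) (hp : ∀ s ∈ S, R (p.app s)) (q : Q) :
    R (p.app q) := by
  by_cases hq : ∃ s ∈ S, s ≤ q
  · obtain ⟨m, hm, hmq, hmax⟩ := hS q hq
    have := hX.isIso_map hmq hm hmax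
    have := hY.isIso_map hmq hm hmax
    exact (R.arrow_mk_iso_iff (Arrow.isoMk (asIso (X.map (homOfLE hmq)))
      (asIso (Y.map (homOfLE hmq))) (p.naturality _))).1 (hp m hm)
  · push Not at hq
    obtain ⟨h⟩ := hX.isInitial hq
    obtain ⟨h'⟩ := hY.isInitial hq
    have : IsIso (p.app q) := ⟨h'.to _, h.hom_ext _ _, h'.hom_ext _ _⟩
    exact R.of_isIso _

end Floors

/-! ### Free functors on finitely many points -/

section Points

variable {Q : Type w} [PartialOrder Q] {C : Type u} [Category.{v} C]

/-- The elements of `T`, ordered discretely. -/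
structure DiscretePoints (T : Finset Q) : Type w where
  /-- the underlying element -/
  pt : Q
  mem : pt ∈ T

instance (T : Finset Q) : PartialOrder (DiscretePoints T) where
  le a b := a = b
  le_refl _ := rfl
  le_trans _ _ _ h h' := h.trans h'
  le_antisymm _ _ h _ := h

instance (T : Finset Q) : Finite (DiscretePoints T) :=
  Finite.of_injective (β := {q // q ∈ T}) (fun a ↦ ⟨a.pt, a.mem⟩) fun a b h ↦ by
    cases a; cases b; simpa using h

/-- The coproduct over `T` of the functors which take the value `A` freely at `s ∈ T`. -/
lemma exists_isTame_free [HasFiniteColimits C] (T : Finset Q) (A : C) :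
    ∃ (X : Q ⥤ C) (η : ∀ s ∈ T, A ⟶ X.obj s), isTame Q C X ∧
      ∀ (q : Q) (Z : C) (k : ∀ s ∈ T, s ≤ q → (A ⟶ Z)),
        ∃! l : X.obj q ⟶ Z, ∀ s (hs : s ∈ T) (hsq : s ≤ q),
          η s hs ≫ X.map (homOfLE hsq) ≫ l = k s hs hsq := by
  let α : DiscretePoints T →o Q := ⟨DiscretePoints.pt, fun a b h ↦ by obtain rfl : a = b := h; rfl⟩
  let Y : DiscretePoints T ⥤ C := (Functor.const _).obj A
  let X := α.monotone.functor.pointwiseLeftKanExtension Y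
  let η : Y ⟶ α.monotone.functor ⋙ X := α.monotone.functor.pointwiseLeftKanExtensionUnit Y
  have hX : X.IsLeftKanExtension η := inferInstance
  refine ⟨X, fun s hs ↦ η.app ⟨s, hs⟩, ⟨_, _, inferInstance, α, Y, η, hX⟩, fun q Z k ↦ ?_⟩
  obtain ⟨l, hl, hl'⟩ := existsUnique_of_isLeftKanExtension η η.app (fun _ ↦ rfl) q Z (fun d hd ↦ k d.pt d.mem hd)
    fun d d' f hd hd' ↦ by
      obtain rfl : d = d' := leOfHom f
      exact Category.id_comp _
  exact ⟨l, fun s hs hsq ↦ hl ⟨s, hs⟩ hsq, fun l' h' ↦ hl' l' fun d hd ↦ h' d.pt d.mem hd⟩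

end Points

/-! ### Consequences of floored generators for `Q` -/

section Transfers

variable {Q : Type w} [PartialOrder Q] {C : Type u} [Category.{v} C] [HasFiniteColimits C]

lemma exists_hasFloors_of_admitsTransfer
    (hdisc : ∀ X : Q ⥤ C, isTame Q C X →
      ∃ (D : Type w) (_ : PartialOrder D) (_ : Finite D) (α : D →o Q),
        AdmitsTransfer α ∧ Discretizes α X) : HasFlooredGenerators Q C := by
  classical
  intro X hX
  obtain ⟨D, _, _, α, h₁, h₂⟩ := hdisc X hX
  have : Fintype D := Fintype.ofFinite D
  exact ⟨Finset.univ.image α, h₁.hasFloors fun q ↦ by simp, h₂.isGeneratedBy fun d ↦ by simp⟩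

/-- The functor free on `A` at the points of `T` must have all of `T` among its generators: a
missing point `s` would make maps differing only at `s` indistinguishable. -/
lemma exists_hasFloors_superset (H : HasFlooredGenerators Q C) {A Z : C} {f g : A ⟶ Z} (hfg : f ≠ g) (T : Finset Q) :
    ∃ S : Finset Q, T ⊆ S ∧ HasFloors S := by
  classical
  obtain ⟨X, η, hX, hη⟩ := exists_isTame_free T A
  obtain ⟨S, hS, hSX⟩ := H X hX
  refine ⟨S, fun s hs ↦ ?_, hS⟩
  by_contra hsS
  obtain ⟨a, ha, -⟩ := hη s Z fun _ _ _ ↦ f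
  obtain ⟨b, hb, -⟩ := hη s Z fun p _ _ ↦ if p = s then g else f
  have hab : a = b := hSX.hom_ext fun s' hs' hs's ↦
    (hη s' Z fun _ _ _ ↦ f).unique
      (fun p hp hps' ↦ by rw [← X.map_comp_assoc]; exact ha p hp (hps'.trans hs's))
      (fun p hp hps' ↦ by
        have hps : p ≠ s := fun e ↦ hsS ((hs's.antisymm (e ▸ hps')) ▸ hs')
        rw [← X.map_comp_assoc]
        exact (hb p hp (hps'.trans hs's)).trans (if_neg hps))
  have h₁ := ha s hs le_rfl
  rw [hab] at h₁
  exact hfg (h₁.symm.trans ((hb s hs le_rfl).trans (if_pos rfl)))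

/-- For incomparable `a` and `b`, a floored set generating the free functor on `A` contains both, so
floors in it of common upper bounds are again common upper bounds. -/
lemma exists_generators_upperBounds_pair (H : HasFlooredGenerators Q C) {A : C} (hA : IsEmpty (IsInitial A))
    (hthin : Quiver.IsThin C) (a b : Q) :
    ∃ G : Finset Q, (∀ g ∈ G, a ≤ g ∧ b ≤ g) ∧ ∀ q, a ≤ q → b ≤ q → ∃ g ∈ G, g ≤ q := by
  classical
  by_cases hab : a ≤ b
  · exact ⟨{b}, by simpa, by simp⟩
  by_cases hba : b ≤ a
  · exact ⟨{a}, by simpa, by simp +contextual⟩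
  obtain ⟨X, η, hX, hη⟩ := exists_isTame_free {a, b} A
  obtain ⟨S, hS, hSX⟩ := H X hX
  -- If a minimal `s` were missing from `S`, the values at elements of `S` below `s` would be
  -- initial, so `X.obj s`, and with it `A`, would map to every object; in a thin category `A` would
  -- be initial.
  have key : ∀ s ∈ ({a, b} : Finset Q), (∀ p ∈ ({a, b} : Finset Q), p ≤ s → p = s) → s ∈ S := by
    intro s hs hmin
    by_contra hsS
    have hinit : ∀ s' ∈ S, s' ≤ s → ∀ p ∈ ({a, b} : Finset Q), ¬ p ≤ s' := fun s' hs' hs's p hp hps' ↦ by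
      obtain rfl := hmin p hp (hps'.trans hs's)
      exact hsS (hs's.antisymm hps' ▸ hs')
    have hZ : ∀ Z : C, Nonempty (X.obj s ⟶ Z) := fun Z ↦ by
      have h₁ : ∀ s' ∈ S, s' ≤ s → Nonempty (X.obj s' ⟶ Z) := fun s' hs' hs's ↦
        ⟨(hη s' Z fun p hp hps' ↦ (hinit s' hs' hs's p hp hps').elim).choose⟩
      exact ⟨(hSX s Z (fun s' hs' hs's ↦ (h₁ s' hs' hs's).some)
        fun _ _ _ _ _ _ _ ↦ Subsingleton.elim _ _).choose⟩
    exact hA.false (IsInitial.ofUniqueHom (fun Z ↦ η s hs ≫ (hZ Z).some)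
      fun _ _ ↦ Subsingleton.elim _ _)
  have ha : a ∈ S := key a (by simp) (by simp [hba])
  have hb : b ∈ S := key b (by simp) (by simp [hab])
  refine ⟨S.filter fun g ↦ a ≤ g ∧ b ≤ g, fun g hg ↦ (Finset.mem_filter.1 hg).2, fun q haq hbq ↦ ?_⟩
  obtain ⟨m, hm, hmq, hmax⟩ := hS q ⟨a, ha, haq⟩
  exact ⟨m, Finset.mem_filter.2 ⟨hm, hmax a ha haq, hmax b hb hbq⟩, hmq⟩

lemma exists_generators_upperBounds (H : HasFlooredGenerators Q C) {A : C} (hA : IsEmpty (IsInitial A))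
    (hthin : Quiver.IsThin C) (F : Finset Q) (hF : F.Nonempty) :
    ∃ G : Finset Q, (∀ g ∈ G, ∀ s ∈ F, s ≤ g) ∧ ∀ q, (∀ s ∈ F, s ≤ q) → ∃ g ∈ G, g ≤ q := by
  classical
  induction hF using Finset.Nonempty.cons_induction with
  | singleton a => exact ⟨{a}, by simp, by simp⟩
  | cons a F ha hF ih =>
    obtain ⟨G, hG, hG'⟩ := ih
    choose K hK hK' using exists_generators_upperBounds_pair H hA hthin a
    refine ⟨G.biUnion K, fun k hk s hs ↦ ?_, fun q hq ↦ ?_⟩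
    · obtain ⟨g, hg, hk⟩ := Finset.mem_biUnion.1 hk
      rcases Finset.mem_cons.1 hs with rfl | hs
      · exact (hK g k hk).1
      · exact (hG g hg s hs).trans (hK g k hk).2
    · obtain ⟨g, hg, hgq⟩ := hG' q fun s hs ↦ hq s (Finset.mem_cons_of_mem hs)
      obtain ⟨k, hk, hkq⟩ := hK' g q (hq a (Finset.mem_cons_self _ _)) hgq
      exact ⟨k, Finset.mem_biUnion.2 ⟨g, hg, hk⟩, hkq⟩

/-- In a thin category generation only asks for some map out of `Z.obj q`. The generators below `q`
have a common upper bound `g ≤ q` in a finite list, and `Z.obj q` maps to `Z.obj g`. If all objects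
are initial, the empty set generates. -/
lemma isTame_of_isThin (H : HasFlooredGenerators Q C) (hthin : Quiver.IsThin C) (Z : Q ⥤ C) (S : Finset Q)
    (h₁ : ∀ q q', (∀ s ∈ S, s ≤ q → s ≤ q') → Nonempty (Z.obj q ⟶ Z.obj q'))
    (h₂ : ∀ q, (∀ s ∈ S, ¬ s ≤ q) → Nonempty (IsInitial (Z.obj q))) : isTame Q C Z := by
  classical
  rw [isTame_iff]
  by_cases hA : ∃ A : C, IsEmpty (IsInitial A)
  · obtain ⟨A, hA⟩ := hA
    choose! G hG hG' using exists_generators_upperBounds H hA hthin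
    refine ⟨(S.powerset.filter (·.Nonempty)).biUnion G, fun q Y k _ ↦ ?_⟩
    suffices Nonempty (Z.obj q ⟶ Y) from
      ⟨this.some, fun _ _ _ ↦ Subsingleton.elim _ _, fun _ _ ↦ Subsingleton.elim _ _⟩
    by_cases hq : ∃ s ∈ S, s ≤ q
    · obtain ⟨s, hs, hsq⟩ := hq
      have hF : (S.filter (· ≤ q)).Nonempty := ⟨s, Finset.mem_filter.2 ⟨hs, hsq⟩⟩
      obtain ⟨g, hg, hgq⟩ := hG' _ hF q fun s hs ↦ (Finset.mem_filter.1 hs).2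
      obtain ⟨l⟩ := h₁ q g fun s hs hsq ↦ hG _ hF g hg s (Finset.mem_filter.2 ⟨hs, hsq⟩)
      exact ⟨l ≫ k g (Finset.mem_biUnion.2 ⟨_, Finset.mem_filter.2
        ⟨Finset.mem_powerset.2 (Finset.filter_subset _ _), hF⟩, hg⟩) hgq⟩
    · push Not at hq
      exact ⟨(h₂ q hq).some.to Y⟩
  · push Not at hA
    exact ⟨∅, fun q Y k _ ↦ ⟨(hA (Z.obj q)).some.to Y, fun _ _ _ ↦ Subsingleton.elim _ _,
      fun _ _ ↦ Subsingleton.elim _ _⟩⟩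

end Transfers

/-! ### Passing between `S` and `Q` -/

section Restriction

variable {Q : Type w} [PartialOrder Q] {C : Type u} [Category.{v} C]

/-- The restriction of a natural transformation to a finite full subposet. -/
abbrev restrictMap (S : Finset Q) {X Y : Q ⥤ C} (φ : X ⟶ Y) : restrict S X ⟶ restrict S Y :=
  Functor.whiskerLeft (finiteInclusion S).monotone.functor φ

lemma IsGeneratedBy.restrictMap_injective {S : Finset Q} {X A : Q ⥤ C} (h : IsGeneratedBy S X)
    {F G : X ⟶ A} (hFG : restrictMap S F = restrictMap S G) : F = G :=
  h.nat_hom_ext fun s hs ↦ NatTrans.congr_app hFG ⟨s, hs⟩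

variable [HasFiniteColimits C] {L : MorphismProperty C} (R : MorphismProperty C)
  [L.IsWeakFactorizationSystem R]

lemma hasLiftingProperty_of_latching_restrictMap {S : Finset Q} {X Y A B : Q ⥤ C}
    (hX : IsGeneratedBy S X) (hY : IsGeneratedBy S Y) (φ : X ⟶ Y) (p : A ⟶ B)
    (hφ : latching L (restrictMap S φ)) (hp : ∀ s ∈ S, R (p.app s)) : HasLiftingProperty φ p where
  sq_hasLift {a b} sq := by
    have : HasLiftingProperty (restrictMap S φ) (restrictMap S p) :=
      hasLiftingProperty_of_latching R _ _ hφ fun s ↦ hp s.1 s.2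
    have sq' : CommSq (restrictMap S a) (restrictMap S φ) (restrictMap S p) (restrictMap S b) :=
      ⟨congrArg (restrictMap S) sq.w⟩
    obtain ⟨l, hl⟩ := hY.exists_extension sq'.lift
    exact ⟨⟨{ l := l
              fac_left := hX.restrictMap_injective (by
                refine Eq.trans ?_ sq'.fac_left
                rw [← hl]
                rfl)
              fac_right := hY.restrictMap_injective (by
                refine Eq.trans ?_ sq'.fac_right
                rw [← hl]
                rfl) }⟩⟩

lemma exists_factorization_extension {S : Finset Q} {X Y : Q ⥤ C}
    (hX : IsGeneratedBy S X) (φ : X ⟶ Y) {W₀ : {q // q ∈ S} ⥤ C}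
    (c₀ : restrict S X ⟶ W₀) (p₀ : W₀ ⟶ restrict S Y) (h : c₀ ≫ p₀ = restrictMap S φ) :
    ∃ (W : Q ⥤ C) (c : X ⟶ W) (p : W ⟶ Y) (e : W₀ ≅ restrict S W), IsGeneratedBy S W ∧
      c ≫ p = φ ∧ restrictMap S c = c₀ ≫ e.hom ∧ restrictMap S p = e.inv ≫ p₀ := by
  obtain ⟨W, hW, ⟨e⟩⟩ := exists_isGeneratedBy_extension S W₀
  obtain ⟨c, hc⟩ := hX.exists_extension (c₀ ≫ e.hom)
  obtain ⟨p, hp⟩ := hW.exists_extension (e.inv ≫ p₀)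
  refine ⟨W, c, p, e, hW, hX.restrictMap_injective ?_, hc, hp⟩
  refine (Functor.whiskerLeft_comp _ c p).trans ?_
  rw [hc, hp, Category.assoc, e.hom_inv_id_assoc, h]

/-- The left class is characterized by lifting, and objectwise lifts are automatically natural. -/
lemma latching_of_objectwise_of_isThin (R : MorphismProperty C) [L.IsWeakFactorizationSystem R]
    {D : Type w} [PartialOrder D] [Finite D]
    (hthin : Quiver.IsThin C) {X Y : D ⥤ C} (φ : X ⟶ Y)
    (hφ : objectwise L φ) : latching L φ := by
  rw [← MorphismProperty.llp_eq_of_wfs (latching L) (objectwise R)]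
  intro A B p hp
  refine ⟨fun {a b} sq ↦ ?_⟩
  have H : ∀ x, Nonempty (Y.obj x ⟶ A.obj x) := fun x ↦ by
    have := MorphismProperty.hasLiftingProperty_of_wfs _ _ (hφ x) (hp x)
    have sq' : CommSq (a.app x) (φ.app x) (p.app x) (b.app x) := ⟨Subsingleton.elim _ _⟩
    exact ⟨sq'.lift⟩
  exact ⟨⟨{ l := { app := fun x ↦ (H x).some, naturality := fun _ _ _ ↦ Subsingleton.elim _ _ }
            fac_left := by ext; exact Subsingleton.elim _ _
            fac_right := by ext; exact Subsingleton.elim _ _ }⟩⟩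

end Restriction

/-! ### Factorizations of tame functors -/

section Factorization

variable {Q : Type w} [PartialOrder Q] {C : Type u} [Category.{v} C] [HasFiniteColimits C]
  (L R : MorphismProperty C) [L.IsWeakFactorizationSystem R]

lemma exists_tame_factorization_of_isThin (H : HasFlooredGenerators Q C) (hthin : Quiver.IsThin C) {X Y : Q ⥤ C}
    (hX : isTame Q C X) (hY : isTame Q C Y) (φ : X ⟶ Y) :
    ∃ (W : Q ⥤ C) (c : X ⟶ W) (p : W ⟶ Y), isTame Q C W ∧ c ≫ p = φ ∧ objectwise L c ∧
      objectwise R p := by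
  let f := fun q ↦ MorphismProperty.factorizationData L R (φ.app q)
  -- Lifting the left part at `q` against the right part at `q'` gives the transition maps of `W`.
  have key : ∀ q q', Nonempty (X.obj q ⟶ X.obj q') → Nonempty (Y.obj q ⟶ Y.obj q') →
      Nonempty ((f q).Z ⟶ (f q').Z) := by
    rintro q q' ⟨a⟩ ⟨b⟩
    have := MorphismProperty.hasLiftingProperty_of_wfs _ _ (f q).hi (f q').hp
    have sq : CommSq (a ≫ (f q').i) (f q).i (f q').p ((f q).p ≫ b) := ⟨Subsingleton.elim _ _⟩
    exact ⟨sq.lift⟩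
  let W : Q ⥤ C :=
    { obj := fun q ↦ (f q).Z
      map := fun {q q'} g ↦ (key q q' ⟨X.map g⟩ ⟨Y.map g⟩).some
      map_id := fun _ ↦ Subsingleton.elim _ _
      map_comp := fun _ _ ↦ Subsingleton.elim _ _ }
  refine ⟨W, { app := fun q ↦ (f q).i, naturality := fun _ _ _ ↦ Subsingleton.elim _ _ },
    { app := fun q ↦ (f q).p, naturality := fun _ _ _ ↦ Subsingleton.elim _ _ }, ?_,
    by ext; exact Subsingleton.elim _ _, fun q ↦ (f q).hi, fun q ↦ (f q).hp⟩
  obtain ⟨S, -, hSX, hSY⟩ := exists_isGeneratedBy_pair hX hY ∅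
  have hS : ∀ {Z : Q ⥤ C}, IsGeneratedBy S Z → ∀ q q', (∀ s ∈ S, s ≤ q → s ≤ q') →
      Nonempty (Z.obj q ⟶ Z.obj q') := fun {Z} hZ q q' h ↦
    ⟨(hZ q (Z.obj q') (fun s hs hsq ↦ Z.map (homOfLE (h s hs hsq)))
      fun _ _ _ _ _ _ _ ↦ Subsingleton.elim _ _).choose⟩
  refine isTame_of_isThin H hthin W S (fun q q' h ↦ key q q' (hS hSX q q' h) (hS hSY q q' h))
    fun q hq ↦ ?_
  -- In a thin category, an object mapping to an initial one is initial.
  obtain ⟨h⟩ := hSY.isInitial hq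
  exact ⟨IsInitial.ofUniqueHom (fun Z ↦ (f q).p ≫ h.to Z) fun _ _ ↦ Subsingleton.elim _ _⟩

lemma isThin_or_exists_ne (C : Type u) [Category.{v} C] :
    Quiver.IsThin C ∨ ∃ (A Z : C) (f g : A ⟶ Z), f ≠ g := by
  by_cases h : ∃ (A Z : C) (f g : A ⟶ Z), f ≠ g
  · exact Or.inr h
  · push Not at h
    exact Or.inl fun A Z ↦ ⟨h A Z⟩

lemma exists_hasFloors_isGeneratedBy (H : HasFlooredGenerators Q C) {A Z : C} {f g : A ⟶ Z} (hfg : f ≠ g) {X Y : Q ⥤ C}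
    (hX : isTame Q C X) (hY : isTame Q C Y) :
    ∃ S : Finset Q, HasFloors S ∧ IsGeneratedBy S X ∧ IsGeneratedBy S Y := by
  obtain ⟨T, -, hTX, hTY⟩ := exists_isGeneratedBy_pair hX hY ∅
  obtain ⟨S, hTS, hS⟩ := exists_hasFloors_superset H hfg T
  exact ⟨S, hS, hTX.mono hTS, hTY.mono hTS⟩

lemma exists_tame_factorization (H : HasFlooredGenerators Q C) {X Y : Q ⥤ C} (hX : isTame Q C X) (hY : isTame Q C Y)
    (φ : X ⟶ Y) :
    ∃ (W : Q ⥤ C) (c : X ⟶ W) (p : W ⟶ Y) (S : Finset Q), IsGeneratedBy S X ∧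
      IsGeneratedBy S Y ∧ IsGeneratedBy S W ∧ c ≫ p = φ ∧ latching L (restrictMap S c) ∧
      objectwise L c ∧ objectwise R p := by
  rcases isThin_or_exists_ne C with hthin | ⟨A, Z, f, g, hfg⟩
  · obtain ⟨W, c, p, hW, fac, hc, hp⟩ := exists_tame_factorization_of_isThin L R H hthin hX hY φ
    obtain ⟨S, -, hS⟩ := exists_isGeneratedBy_of_finite (fun i : Fin 3 ↦ ![X, Y, W] i)
      (by intro i; fin_cases i <;> assumption) ∅
    exact ⟨W, c, p, S, hS 0, hS 1, hS 2, fac,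
      latching_of_objectwise_of_isThin R hthin _ fun s ↦ hc s.1, hc, hp⟩
  · obtain ⟨S, hS, hSX, hSY⟩ := exists_hasFloors_isGeneratedBy H hfg hX hY
    have hL : L.IsStableUnderRetracts ∧ L.IsMultiplicative := by
      rw [← MorphismProperty.llp_eq_of_wfs L R]; exact ⟨inferInstance, inferInstance⟩
    have hR : R.IsStableUnderRetracts ∧ R.IsMultiplicative := by
      rw [← MorphismProperty.rlp_eq_of_wfs L R]; exact ⟨inferInstance, inferInstance⟩
    have := hL.1
    have := hL.2
    have := hR.1
    have := hR.2
    let h := MorphismProperty.factorizationData (latching L) (objectwise R) (restrictMap S φ)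
    obtain ⟨W, c, p, e, hW, fac, hc, hp⟩ := exists_factorization_extension hSX φ h.i h.p h.fac
    have hc' : latching L (restrictMap S c) := by
      rw [hc]
      exact ((latching L).cancel_right_of_respectsIso _ _).2 h.hi
    have hp' : objectwise R (restrictMap S p) := by
      rw [hp]
      exact ((objectwise R).cancel_left_of_respectsIso _ _).2 h.hp
    refine ⟨W, c, p, S, hSX, hSY, hW, fac, hc', ?_, ?_⟩
    · exact hS.objectwise hSX hW L c fun s hs ↦ objectwise_of_latching R _ hc' ⟨s, hs⟩
    · exact hS.objectwise hW hSY R p fun s hs ↦ hp' ⟨s, hs⟩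

end Factorization

/-! ### Finite limits and colimits of tame functors -/

section Closure

/-- Initial objects are then zero objects, and limits of zero objects, the empty limit included, are
zero. -/
lemma isInitial_pt_of_hasZeroObject {C : Type u} [Category.{v} C] [HasZeroObject C] {J : Type*}
    [Category* J] {K : J ⥤ C} {c : Cone K} (hc : IsLimit c)
    (hK : ∀ j, Nonempty (IsInitial (K.obj j))) : Nonempty (IsInitial c.pt) := by
  obtain ⟨z, hz⟩ := HasZeroObject.zero (C := C)
  have hK' : ∀ j, IsZero (K.obj j) := fun j ↦ hz.of_iso ((hK j).some.uniqueUpToIso hz.isInitial)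
  let e : z ≅ c.pt :=
    { hom := hz.to_ _
      inv := hz.from_ _
      hom_inv_id := hz.eq_of_src _ _
      inv_hom_id := hc.hom_ext fun j ↦ (hK' j).eq_of_tgt _ _ }
  exact ⟨hz.isInitial.ofIso e⟩

variable {Q : Type w} [PartialOrder Q] {C : Type u} [Category.{v} C] [HasFiniteColimits C]

instance isTame_isClosedUnderColimitsOfShape (J : Type) [SmallCategory J] [FinCategory J] :
    (isTame Q C).IsClosedUnderColimitsOfShape J where
  colimitsOfShape_le X := by
    rintro ⟨h⟩
    obtain ⟨S, -, hS⟩ := exists_isGeneratedBy_of_finite h.diag.obj h.prop_diag_obj ∅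
    exact (isTame_iff X).2 ⟨S, isGeneratedBy_of_isColimit h.isColimit hS⟩

variable [HasFiniteLimits C]

/-- Limits are objectwise, so over a common floored set they inherit invertible maps out of floors.
Where no generator lies below `q`, either the zero object applies or including `S₀` in the
generators excludes the case. -/
lemma isTame_of_isLimit
    (H : HasFlooredGenerators Q C)
    (hterm : HasZeroObject C ∨ ∃ S : Finset Q, ∀ q : Q, ∃ s ∈ S, s ≤ q)
    {J : Type} [SmallCategory J] [FinCategory J] {F : J ⥤ Q ⥤ C}
    (hF : ∀ j, isTame Q C (F.obj j)) {c : Cone F} (hc : IsLimit c) : isTame Q C c.pt := by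
  obtain ⟨S₀, hS₀⟩ : ∃ S₀ : Finset Q, HasZeroObject C ∨ ∀ q : Q, ∃ s ∈ S₀, s ≤ q := by
    rcases hterm with h | ⟨S₀, h⟩
    · exact ⟨∅, Or.inl h⟩
    · exact ⟨S₀, Or.inr h⟩
  have hq := fun q ↦ isLimitOfPreserves ((evaluation Q C).obj q) hc
  have hinit : ∀ {S : Finset Q}, S₀ ⊆ S → (∀ j, IsGeneratedBy S (F.obj j)) →
      ∀ q, (∀ s ∈ S, ¬ s ≤ q) → Nonempty (IsInitial (c.pt.obj q)) := by
    intro S hS hSF q hSq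
    rcases hS₀ with h | h
    · exact isInitial_pt_of_hasZeroObject (hq q) fun j ↦ (hSF j).isInitial hSq
    · obtain ⟨s, hs, hsq⟩ := h q
      exact (hSq s (hS hs) hsq).elim
  obtain ⟨T, hT, hTF⟩ := exists_isGeneratedBy_of_finite F.obj hF S₀
  rcases isThin_or_exists_ne C with hthin | ⟨A, Z, f, g, hfg⟩
  · refine isTame_of_isThin H hthin c.pt T (fun q q' h ↦ ?_) (hinit hT hTF)
    have h' : ∀ j, Nonempty ((F.obj j).obj q ⟶ (F.obj j).obj q') := fun j ↦
      ⟨(hTF j q _ (fun s hs hsq ↦ (F.obj j).map (homOfLE (h s hs hsq)))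
        fun _ _ _ _ _ _ _ ↦ Subsingleton.elim _ _).choose⟩
    let e : Cone (F ⋙ (evaluation Q C).obj q') :=
      { pt := c.pt.obj q
        π := { app := fun j ↦ (c.π.app j).app q ≫ (h' j).some
               naturality := fun _ _ _ ↦ Subsingleton.elim _ _ } }
    exact ⟨(hq q').lift e⟩
  · obtain ⟨S, hTS, hS⟩ := exists_hasFloors_superset H hfg T
    have hSF := fun j ↦ (hTF j).mono hTS
    refine (isTame_iff _).2 ⟨S, hS.isGeneratedBy (fun m q hmq hm hmax ↦ ?_)
      (hinit (hT.trans hTS) hSF)⟩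
    let a : F ⋙ (evaluation Q C).obj m ⟶ F ⋙ (evaluation Q C).obj q :=
      Functor.whiskerLeft F ((evaluation Q C).map (homOfLE hmq))
    have : ∀ j, IsIso (a.app j) := fun j ↦ (hSF j).isIso_map hmq hm hmax
    have : IsIso a := NatIso.isIso_of_isIso_app a
    have e : ((hq m).conePointsIsoOfNatIso (hq q) (asIso a)).hom = c.pt.map (homOfLE hmq) :=
      (hq q).hom_ext fun j ↦ by
        rw [IsLimit.conePointsIsoOfNatIso_hom_comp]
        exact ((c.π.app j).naturality (homOfLE hmq)).symm
    exact e ▸ Iso.isIso_hom _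

end Closure

/-! ### Weak factorization systems on tame functors -/

section TameMorphisms

variable {Q : Type w} [PartialOrder Q] {C : Type u} [Category.{v} C]

/-- The morphisms of tame functors which are objectwise in `R`. -/
def tameObjectwise (R : MorphismProperty C) : MorphismProperty (Tame Q C) :=
  (objectwise R).inverseImage (isTame Q C).ι

instance (R : MorphismProperty C) [R.IsStableUnderRetracts] :
    (tameObjectwise R : MorphismProperty (Tame Q C)).IsStableUnderRetracts :=
  inferInstanceAs ((objectwise R).inverseImage (isTame Q C).ι).IsStableUnderRetracts

instance (R : MorphismProperty C) [R.HasTwoOutOfThreeProperty] :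
    (tameObjectwise R : MorphismProperty (Tame Q C)).HasTwoOutOfThreeProperty where
  comp_mem _ _ hf hg x := R.comp_mem _ _ (hf x) (hg x)
  of_postcomp f g hg hfg x := R.of_postcomp (f.hom.app x) (g.hom.app x) (hg x) (hfg x)
  of_precomp f g hf hfg x := R.of_precomp (f.hom.app x) (g.hom.app x) (hf x) (hfg x)

lemma tameObjectwise_inf (R₁ R₂ : MorphismProperty C) :
    (tameObjectwise R₁ ⊓ tameObjectwise R₂ : MorphismProperty (Tame Q C)) =
      tameObjectwise (R₁ ⊓ R₂) := by
  ext X Y φ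
  exact forall_and.symm

variable [HasFiniteColimits C]

/-- The morphisms of tame functors whose restriction to some finite full subposet discretizing
the source and the target has its mediating morphisms in `L`. -/
def tameLatching (L : MorphismProperty C) : MorphismProperty (Tame Q C) :=
  fun X Y φ ↦ ∃ S : Finset Q, IsGeneratedBy S X.obj ∧ IsGeneratedBy S Y.obj ∧
    latching L (restrictMap S φ.hom)

variable {L : MorphismProperty C} (R : MorphismProperty C) [L.IsWeakFactorizationSystem R]

lemma hasLiftingProperty_of_tameLatching {X Y A B : Tame Q C} (φ : X ⟶ Y) (p : A ⟶ B)
    (hφ : tameLatching L φ) (hp : tameObjectwise R p) : HasLiftingProperty φ p where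
  sq_hasLift {a b} sq := by
    obtain ⟨S, hX, hY, h⟩ := hφ
    have := hasLiftingProperty_of_latching_restrictMap R hX hY φ.hom p.hom h fun s _ ↦ hp s
    have sq' : CommSq a.hom φ.hom p.hom b.hom := ⟨congrArg InducedCategory.Hom.hom sq.w⟩
    exact ⟨⟨{ l := ObjectProperty.homMk sq'.lift
              fac_left := ObjectProperty.hom_ext _ sq'.fac_left
              fac_right := ObjectProperty.hom_ext _ sq'.fac_right }⟩⟩

variable (L) in
lemma tame_isWeakFactorizationSystem (H : HasFlooredGenerators Q C) :
    (tameLatching L : MorphismProperty (Tame Q C)).IsWeakFactorizationSystem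
      (tameObjectwise R) := by
  have hL : L.IsStableUnderRetracts := by
    rw [← MorphismProperty.llp_eq_of_wfs L R]; infer_instance
  have hR : R.IsStableUnderRetracts := by
    rw [← MorphismProperty.rlp_eq_of_wfs L R]; infer_instance
  have hle : (tameLatching L : MorphismProperty (Tame Q C)) ≤ (tameObjectwise R).llp :=
    fun _ _ i hi _ _ p hp ↦ hasLiftingProperty_of_tameLatching R i p hi hp
  have hfac : MorphismProperty.HasFactorization (tameLatching L : MorphismProperty (Tame Q C))
      (tameObjectwise R) := ⟨fun {X Y} φ ↦ by
    obtain ⟨W, c, p, S, hX, hY, hW, fac, hc, -, hp⟩ :=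
      exists_tame_factorization L R H X.property Y.property φ.hom
    exact ⟨⟨⟨W, (isTame_iff W).2 ⟨S, hW⟩⟩, ObjectProperty.homMk c, ObjectProperty.homMk p,
      ObjectProperty.hom_ext _ fac, ⟨S, hX, hW, hc⟩, hp⟩⟩⟩
  refine ⟨?_, le_antisymm (fun X Y φ hφ ↦ ?_) hle, hfac⟩
  · exact MorphismProperty.rlp_eq_of_le_rlp_of_hasFactorization_of_isStableUnderRetracts
      fun _ _ p hp _ _ i hi ↦ hasLiftingProperty_of_tameLatching R i p hi hp
  · obtain ⟨W, c, p, S, hX, hY, hW, fac, hc, -, hp⟩ :=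
      exists_tame_factorization L R H X.property Y.property φ.hom
    let W' : Tame Q C := ⟨W, (isTame_iff W).2 ⟨S, hW⟩⟩
    let c' : X ⟶ W' := ObjectProperty.homMk c
    let p' : W' ⟶ Y := ObjectProperty.homMk p
    have fac' : c' ≫ p' = φ := ObjectProperty.hom_ext _ fac
    have := hφ p' hp
    -- As one `S` generates `X`, `Y` and `W`, restricting the retract diagram to `S` suffices.
    have h := (RetractArrow.ofLeftLiftingProperty fac').map ((isTame Q C).ι ⋙
      (Functor.whiskeringLeft _ _ C).obj (finiteInclusion S).monotone.functor)
    exact ⟨S, hX, hY, (latching L).of_retract h hc⟩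

end TameMorphisms

/-! ### Trivial cofibrations and minimality for tame functors -/

section TrivialCofibrations

variable {C : Type u} [Category.{v} C] [ModelCategory C]

/-- In a factorization of `φ` by the trivial cofibration system, two-out-of-three makes the right
part a trivial fibration; `φ` lifts against it and so is a retract of the left part. -/
lemma latching_trivialCofibrations {D : Type w} [PartialOrder D] [Finite D] {X Y : D ⥤ C}
    (φ : X ⟶ Y) (h₁ : latching (cofibrations C) φ) (h₂ : objectwise (weakEquivalences C) φ) :
    latching (trivialCofibrations C) φ := by
  have : (trivialCofibrations C).IsStableUnderRetracts := by
    rw [← MorphismProperty.llp_eq_of_wfs (trivialCofibrations C) (fibrations C)]; infer_instance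
  let h := MorphismProperty.factorizationData (latching (trivialCofibrations C))
    (objectwise (fibrations C)) φ
  have hi := objectwise_of_latching (fibrations C) h.i h.hi
  have hp : objectwise (trivialFibrations C) h.p := fun x ↦ by
    refine ⟨h.hp x, (weakEquivalences C).of_precomp (h.i.app x) (h.p.app x) (hi x).2 ?_⟩
    have := NatTrans.congr_app h.fac x
    rw [NatTrans.comp_app] at this
    rw [this]
    exact h₂ x
  have := hasLiftingProperty_of_latching (trivialFibrations C) φ h.p h₁ hp
  exact (latching _).of_retract (RetractArrow.ofLeftLiftingProperty h.fac) h.hi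

variable {Q : Type w} [PartialOrder Q]

lemma tameWeakEquivalences_eq : tameWeakEquivalences Q C = tameObjectwise (weakEquivalences C) := by
  ext X Y φ
  exact forall_congr' fun x ↦ weakEquivalence_iff _

lemma tameFibrations_eq : tameFibrations Q C = tameObjectwise (fibrations C) := by
  ext X Y φ
  exact forall_congr' fun x ↦ fibration_iff _

lemma tameCofibrations_eq : tameCofibrations Q C = tameLatching (cofibrations C) := by
  ext X Y φ
  refine exists_congr fun S ↦ ?_
  rw [discretizes_finiteInclusion_iff, discretizes_finiteInclusion_iff]
  exact and_congr_right fun _ ↦ and_congr_right fun _ ↦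
    forall_congr' fun x ↦ cofibration_iff _

lemma tame_isWeakFactorizationSystem_cofibrations (H : HasFlooredGenerators Q C) :
    (tameCofibrations Q C).IsWeakFactorizationSystem
      (tameFibrations Q C ⊓ tameWeakEquivalences Q C) := by
  rw [tameCofibrations_eq, tameFibrations_eq, tameWeakEquivalences_eq, tameObjectwise_inf]
  exact tame_isWeakFactorizationSystem (cofibrations C) (trivialFibrations C) H

lemma tame_isWeakFactorizationSystem_fibrations (H : HasFlooredGenerators Q C) :
    (tameCofibrations Q C ⊓ tameWeakEquivalences Q C).IsWeakFactorizationSystem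
      (tameFibrations Q C) := by
  have := tame_isWeakFactorizationSystem_cofibrations H
  have hc : (tameCofibrations Q C).IsStableUnderRetracts := by
    rw [← MorphismProperty.llp_eq_of_wfs (tameCofibrations Q C)
      (tameFibrations Q C ⊓ tameWeakEquivalences Q C)]
    infer_instance
  rw [tameCofibrations_eq] at hc
  rw [tameCofibrations_eq, tameFibrations_eq, tameWeakEquivalences_eq]
  have hfac : MorphismProperty.HasFactorization
      (tameLatching (cofibrations C) ⊓ tameObjectwise (weakEquivalences C) :
        MorphismProperty (Tame Q C)) (tameObjectwise (fibrations C)) := ⟨fun {X Y} φ ↦ by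
    obtain ⟨W, c, p, S, hX, hY, hW, fac, hc, hc', hp⟩ :=
      exists_tame_factorization (trivialCofibrations C) (fibrations C) H X.property Y.property φ.hom
    exact ⟨⟨⟨W, (isTame_iff W).2 ⟨S, hW⟩⟩, ObjectProperty.homMk c, ObjectProperty.homMk p,
      ObjectProperty.hom_ext _ fac, ⟨⟨S, hX, hW, fun x ↦ (hc x).1⟩, fun q ↦ (hc' q).2⟩, hp⟩⟩⟩
  exact .mk' _ _ fun i p hi hp ↦ by
    obtain ⟨⟨S, hX, hY, h⟩, hw⟩ := hi
    exact hasLiftingProperty_of_tameLatching (fibrations C) i p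
      ⟨S, hX, hY, latching_trivialCofibrations _ h fun s ↦ hw s.1⟩ hp

/-- In the thin case endomorphisms are identities. Otherwise minimality holds over a floored `S`,
and an endomorphism invertible on `S` is invertible everywhere by floors. -/
lemma exists_isMinimalFactorization_tame (H : HasFlooredGenerators Q C) (hmin : MinimalCofibrantFactorizationAxiom C)
    {X Y : Tame Q C} (φ : X ⟶ Y) :
    ∃ (W : Tame Q C) (c : X ⟶ W) (p : W ⟶ Y), c ≫ p = φ ∧ tameCofibrations Q C c ∧
      tameFibrations Q C p ∧ tameWeakEquivalences Q C p ∧ IsMinimalFactorization c p := by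
  rw [tameCofibrations_eq, tameFibrations_eq, tameWeakEquivalences_eq]
  rcases isThin_or_exists_ne C with hthin | ⟨A, Z, f, g, hfg⟩
  · obtain ⟨W, c, p, S, hX, hY, hW, fac, hc, -, hp⟩ :=
      exists_tame_factorization (cofibrations C) (trivialFibrations C) H X.property Y.property
        φ.hom
    refine ⟨⟨W, (isTame_iff W).2 ⟨S, hW⟩⟩, ObjectProperty.homMk c, ObjectProperty.homMk p,
      ObjectProperty.hom_ext _ fac, ⟨S, hX, hW, hc⟩, fun q ↦ (hp q).1, fun q ↦ (hp q).2,
      fun ψ _ _ ↦ ?_⟩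
    obtain rfl : ψ = 𝟙 _ := ObjectProperty.hom_ext _ (by ext; exact Subsingleton.elim _ _)
    infer_instance
  · obtain ⟨S, hS, hSX, hSY⟩ := exists_hasFloors_isGeneratedBy H hfg X.property Y.property
    obtain ⟨W₀, c₀, p₀, fac₀, hc₀, hp₀, hm₀⟩ :=
      exists_isMinimalFactorization_functor hmin (restrictMap S φ.hom)
    obtain ⟨W, c, p, e, hW, fac, hc, hp⟩ := exists_factorization_extension hSX φ.hom c₀ p₀ fac₀
    have hc' : latching (cofibrations C) (restrictMap S c) := by
      rw [hc]
      exact ((latching (cofibrations C)).cancel_right_of_respectsIso _ _).2 hc₀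
    have : (trivialFibrations C).IsStableUnderRetracts ∧ (trivialFibrations C).IsMultiplicative := by
      rw [← MorphismProperty.rlp_eq_of_wfs (cofibrations C) (trivialFibrations C)]
      exact ⟨inferInstance, inferInstance⟩
    have := this.1
    have hp' : objectwise (trivialFibrations C) (restrictMap S p) := by
      rw [hp]
      exact ((objectwise (trivialFibrations C)).cancel_left_of_respectsIso _ _).2 hp₀
    have hpq := hS.objectwise hW hSY (trivialFibrations C) p fun s hs ↦ hp' ⟨s, hs⟩
    refine ⟨⟨W, (isTame_iff W).2 ⟨S, hW⟩⟩, ObjectProperty.homMk c, ObjectProperty.homMk p,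
      ObjectProperty.hom_ext _ fac, ⟨S, hSX, hW, hc'⟩, fun q ↦ (hpq q).1, fun q ↦ (hpq q).2,
      fun ψ h₁ h₂ ↦ ?_⟩
    have h₁' : restrictMap S c ≫ restrictMap S ψ.hom = restrictMap S c :=
      congrArg (restrictMap S) (congrArg InducedCategory.Hom.hom h₁)
    have h₂' : restrictMap S ψ.hom ≫ restrictMap S p = restrictMap S p :=
      congrArg (restrictMap S) (congrArg InducedCategory.Hom.hom h₂)
    rw [hc, Category.assoc] at h₁'
    rw [hp] at h₂'
    have hiso : IsIso (e.hom ≫ restrictMap S ψ.hom ≫ e.inv) := hm₀ _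
      (by rw [reassoc_of% h₁', e.hom_inv_id, Category.comp_id])
      (by rw [Category.assoc, Category.assoc, h₂', e.hom_inv_id_assoc])
    have hψ : IsIso (restrictMap S ψ.hom) := by
      have := (MorphismProperty.isomorphisms _).cancel_left_of_respectsIso e.hom
        (restrictMap S ψ.hom ≫ e.inv)
      have h := this.1 hiso
      exact ((MorphismProperty.isomorphisms _).cancel_right_of_respectsIso _ _).1 h
    have hψq : ∀ q, IsIso (ψ.hom.app q) := hS.objectwise hW hW (MorphismProperty.isomorphisms C)
      ψ.hom fun s hs ↦ inferInstanceAs (IsIso ((restrictMap S ψ.hom).app ⟨s, hs⟩))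
    have : IsIso ((isTame Q C).ι.map ψ) := NatIso.isIso_of_isIso_app (F := W) (G := W) ψ.hom
    exact isIso_of_reflects_iso ψ (isTame Q C).ι

end TrivialCofibrations

end TameFunctors

/-! ### The model structure -/

theorem mainTheorem4 {Q : Type w} [PartialOrder Q]
    {C : Type u} [Category.{v} C] [ModelCategory C]
    (hdisc : ∀ X : Q ⥤ C, isTame Q C X →
      ∃ (D : Type w) (_ : PartialOrder D) (_ : Finite D) (α : D →o Q),
        AdmitsTransfer α ∧ Discretizes α X)
    (hterm : HasZeroObject C ∨ ∃ S : Finset Q, ∀ q : Q, ∃ s ∈ S, s ≤ q) :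
    ∃ M : ModelCategory (Tame Q C),
      M.categoryWithWeakEquivalences.weakEquivalences = tameWeakEquivalences Q C ∧
      M.categoryWithFibrations.fibrations = tameFibrations Q C ∧
      M.categoryWithCofibrations.cofibrations = tameCofibrations Q C ∧
      (MinimalCofibrantFactorizationAxiom C →
        @MinimalCofibrantFactorizationAxiom (Tame Q C) _ M) := by
  have H := exists_hasFloors_of_admitsTransfer hdisc
  let _ : CategoryWithFibrations (Tame Q C) := ⟨tameFibrations Q C⟩
  let _ : CategoryWithCofibrations (Tame Q C) := ⟨tameCofibrations Q C⟩
  let _ : CategoryWithWeakEquivalences (Tame Q C) := ⟨tameWeakEquivalences Q C⟩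
  have : HasFiniteLimits (Tame Q C) := ⟨fun J _ _ ↦ by
    have : (isTame Q C).IsClosedUnderLimitsOfShape J :=
      ⟨by rintro X ⟨h⟩; exact isTame_of_isLimit H hterm h.prop_diag_obj h.isLimit⟩
    infer_instance⟩
  have : HasFiniteColimits (Tame Q C) := ⟨fun J _ _ ↦ inferInstance⟩
  have : (weakEquivalences (Tame Q C)).HasTwoOutOfThreeProperty := by
    change (tameWeakEquivalences Q C).HasTwoOutOfThreeProperty
    rw [tameWeakEquivalences_eq]
    infer_instance
  have : (cofibrations (Tame Q C)).IsWeakFactorizationSystem (trivialFibrations (Tame Q C)) :=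
    tame_isWeakFactorizationSystem_cofibrations H
  have : (trivialCofibrations (Tame Q C)).IsWeakFactorizationSystem (fibrations (Tame Q C)) :=
    tame_isWeakFactorizationSystem_fibrations H
  refine ⟨ModelCategory.mk' _, rfl, rfl, rfl, fun hmin X Y φ ↦ ?_⟩
  obtain ⟨W, c, p, fac, hc, hp, hp', hm⟩ := exists_isMinimalFactorization_tame H hmin φ
  exact ⟨W, c, p, fac, ⟨hc⟩, ⟨hp⟩, ⟨hp'⟩, hm⟩
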